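/- Let $d\in\{1,2\}$, $\alpha\in(d,2d)$, $\beta\in\mathbb R$, and let $q\ge 1$ be an integer with $q>|\beta|\,\pi\sum_{x\in\mathbb Z^d\setminus\{0\}}|x|^{-\alpha}$, where $|\cdot|$ is the Euclidean norm. Let $\lambda$ be Lebesgue measure on $\mathbb S^1\subset\mathbb R^2$ (total mass $2\pi$), $\Omega_I=(\mathbb S^1)^I$ for $I\subset\mathbb Z^d$, and let $T:\mathbb S^1\simeq[0,2\pi)\to\{0,\dots,q-1\}$ be the discretisation $T(\varphi)=k$ iff $\varphi\in[2\pi k/q,2\pi(k+1)/q)$, applied coordinatewise to configurations. Consider the potential $\Phi_{\{x,y\}}(\omega)=|x-y|^{-\alpha}\,\omega_x\cdot\omega_y$ for $x\ne y$, and $\Phi_A=0$ for all other finite sets $A$. For $I\subset\mathbb Z^d$ and finite $\Delta\subset I$ put $\mathcal H^I_\Delta=\sum_{A\subset I,\,A\cap\Delta\neq\emptyset}\Phi_A$ and $\mathcal H_\Delta=\mathcal H_\Delta^{\mathbb Z^d}$. For a finite $\Lambda\subset\mathbb Z^d$ and $\omega'\in\{0,\dots,q-1\}^{\Lambda^c}$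 let $\gamma^{\omega'}|_{\Lambda^c}$ be the family of kernels on $\Omega_{\Lambda^c}$, indexed by the finite sets $\Delta\subset\Lambda^c$, under which, given $\eta$, the configuration equals $\eta$ outside $\Delta$ and its restriction to $\Delta$ has law $$\frac{1}{Z}\,\mathbf 1\{T(\zeta)=\omega'_\Delta\}\,e^{-\beta\mathcal H^{\Lambda^c}_\Delta(\zeta\,\eta_{\Lambda^c\setminus\Delta})}\,\lambda^{\otimes\Delta}(d\zeta).$$ Then for all such $\Lambda$ and $\omega'$ there is exactly one Gibbs measure $\mu_{\Lambda^c}[\omega']$ for $\gamma^{\omega'}|_{\Lambda^c}$, that is, exactly one probability measure on $\Omega_{\Lambda^c}$ that satisfies its DLR equations. Consequently the discretised specification $$\gamma'_\Lambda(\omega'_\Lambda\mid\omega'_{\Lambda^c})=\frac{\mu_{\Lambda^c}[\omega'_{\Lambda^c}]\big(\lambda^{\otimes\Lambda}(e^{-\beta\mathcal H_\Lambda}\mathbf 1\{T(\cdot_\Lambda)=\omega'_\Lambda\})\big)}{\mu_{\Lambda^c}[\omega'_{\Lambda^c}]\big(\lambda^{\otimes\Lambda}(e^{-\beta\mathcal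 H_\Lambda})\big)},\qquad \omega'\in\Omega'=\{0,\dots,q-1\}^{\mathbb Z^d},$$ is well defined, and it has the following properties. 1. It is translation invariant: for all finite $\Lambda\subset\mathbb Z^d$, $i\in\mathbb Z^d$ and $\eta\in\Omega'$, with $(\tau_i\eta)_x=\eta_{x-i}$, $$\gamma'_{\Lambda+i}\big((\tau_i\eta)_{\Lambda+i}\mid(\tau_i\eta)_{(\Lambda+i)^c}\big)=\gamma'_\Lambda(\eta_\Lambda\mid\eta_{\Lambda^c}).$$ 2. It is nonnull: there is $\delta>0$ with $\gamma'_{\{0\}}(\eta_0\mid\eta_{0^c})\ge\delta$ for all $\eta\in\Omega'$. 3. It has summable oscillations: $\sum_{x\neq0}\delta_x(\gamma'_0)<\infty$, where $\gamma'_0$ is the function $\eta\mapsto\gamma'_{\{0\}}(\eta_0\mid\eta_{0^c})$ on $\Omega'$ and $\delta_x(f)=\sup\{|f(\eta)-f(\xi)|:\eta_y=\xi_y\text{ for all }y\ne x\}$. -/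

import Mathlib

namespace LongRangeXY

open MeasureTheory Set

noncomputable section

/-! ### Lattice, spins, discretisation -/

/-- The lattice `ℤ^d`. -/
abbrev Site (d : ℕ) := Fin d → ℤ

/-- The Euclidean norm of a lattice point. -/
def siteNorm {d : ℕ} (x : Site d) : ℝ := Real.sqrt (∑ i, (x i : ℝ) ^ 2)

instance : MeasurableSpace Circle := borel Circle

instance : BorelSpace Circle := ⟨rfl⟩

/-- Lebesgue (arc length) measure on the circle, of total mass `2π`. -/
def circleMeasure : Measure Circle :=
  (volume.restrict (Ico (0 : ℝ) (2 * Real.pi))).map Circle.exp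

/-- The angle in `[0, 2π)` of a point of the circle. -/
def angle (z : Circle) : ℝ := toIcoMod Real.two_pi_pos 0 (Complex.arg (z : ℂ))

/-- The discretisation map: `discretise q z = k` iff the angle of `z` lies in
`[2πk/q, 2π(k+1)/q)`. The `q` arcs are labelled `0, …, q - 1`. -/
def discretise (q : ℕ) [NeZero q] (z : Circle) : Fin q :=
  Fin.ofNat q ⌊angle z * q / (2 * Real.pi)⌋₊

theorem discretise_eq_iff (q : ℕ) [NeZero q] (z : Circle) (k : Fin q) :
    discretise q z = k ↔
      angle z ∈ Ico (2 * Real.pi * k / q) (2 * Real.pi * (k + 1) / q) := by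
  have hq : (0 : ℝ) < q := Nat.cast_pos.mpr (NeZero.pos q)
  have hp : (0 : ℝ) < 2 * Real.pi := Real.two_pi_pos
  have h0 : 0 ≤ angle z := (toIcoMod_mem_Ico Real.two_pi_pos 0 _).1
  have h1 : angle z < 2 * Real.pi :=
    (toIcoMod_mem_Ico Real.two_pi_pos 0 (Complex.arg (z : ℂ))).2.trans_eq (zero_add _)
  have hlt : ⌊angle z * q / (2 * Real.pi)⌋₊ < q := by
    rw [Nat.floor_lt (by positivity), div_lt_iff₀ hp]
    nlinarith
  rw [Fin.ext_iff]
  simp only [discretise, Fin.ofNat, Nat.mod_eq_of_lt hlt]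
  rw [Nat.floor_eq_iff (by positivity), le_div_iff₀ hp, div_lt_iff₀ hp, mem_Ico, div_le_iff₀ hq,
    lt_div_iff₀ hq, mul_comm (k : ℝ), mul_comm ((k : ℝ) + 1)]

/-! ### Potential and Gibbsian specification

The sites are the elements of a type `I` with positions `pos : I → ℤ^d`; it is used for `ℤ^d` itself
and for the complement `ℤ^d \ Λ` of a finite set `Λ`. In the latter case only the potentials `Φ_A`
with `A ⊆ ℤ^d \ Λ` are present. -/

variable {d : ℕ} {I : Type} [DecidableEq I]

/-- The potential: `Φ_{x,y}(ω) = |x - y|^{-α} ω(x) · ω(y)` for `x ≠ y`, and `Φ_A = 0` if `A` does not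
have exactly two elements. (The sum below runs over `(x, y)` and `(y, x)`.) -/
def potential (pos : I → Site d) (α : ℝ) (A : Finset I) (ω : I → Circle) : ℝ :=
  if A.card = 2 then
    (∑ p ∈ A.offDiag,
      siteNorm (pos p.1 - pos p.2) ^ (-α) * inner ℝ (ω p.1 : ℂ) (ω p.2 : ℂ)) / 2
  else 0

theorem potential_pair (pos : I → Site d) (α : ℝ) {x y : I} (h : x ≠ y) (ω : I → Circle) :
    potential pos α {x, y} ω =
      siteNorm (pos x - pos y) ^ (-α) * inner ℝ (ω x : ℂ) (ω y : ℂ) := by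
  have hs : siteNorm (pos y - pos x) = siteNorm (pos x - pos y) := by
    unfold siteNorm
    congr 1
    refine Finset.sum_congr rfl fun i _ => ?_
    simp only [Pi.sub_apply, Int.cast_sub]
    ring
  have ho : ({x, y} : Finset I).offDiag = {(x, y), (y, x)} := by
    ext ⟨a, b⟩
    simp only [Finset.mem_offDiag, Finset.mem_insert, Finset.mem_singleton, Prod.mk.injEq]
    constructor
    · rintro ⟨rfl | rfl, rfl | rfl, hab⟩ <;> simp_all
    · rintro (⟨rfl, rfl⟩ | ⟨rfl, rfl⟩) <;> simp [h, h.symm]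
  have hn : (x, y) ≠ (y, x) := fun e => h (Prod.mk.inj e).1
  rw [potential, if_pos (Finset.card_pair h), ho, Finset.sum_pair hn]
  simp only [hs, real_inner_comm (ω x : ℂ) (ω y : ℂ)]
  ring

/-- The Hamiltonian `H_Δ = ∑_{A ∩ Δ ≠ ∅} Φ_A`. -/
def hamiltonian (pos : I → Site d) (α : ℝ) (Δ : Finset I) (ω : I → Circle) : ℝ :=
  ∑' A : {A : Finset I // (A ∩ Δ).Nonempty}, potential pos α A ω

/-- The configuration equal to `ζ` in `Δ` and to `η` outside `Δ`. -/
def glue (Δ : Finset I) (ζ : Δ → Circle) (η : I → Circle) : I → Circle :=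
  fun x => if h : x ∈ Δ then ζ ⟨x, h⟩ else η x

/-- The measure `B ↦ ∫ 1_B(ζ η_{Δᶜ}) exp (-β H_Δ(ζ η_{Δᶜ})) λ^Δ(dζ)`. -/
def boltzmann (pos : I → Site d) (α β : ℝ) (Δ : Finset I) (η : I → Circle) :
    Measure (I → Circle) :=
  ((Measure.pi fun _ : Δ => circleMeasure).withDensity fun ζ =>
    ENNReal.ofReal (Real.exp (-β * hamiltonian pos α Δ (glue Δ ζ η)))).map fun ζ => glue Δ ζ η

/-- The Gibbsian specification `γ_Δ(· | η)`: the previous measure, normalised. -/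
def gibbsSpec (pos : I → Site d) (α β : ℝ) (Δ : Finset I) (η : I → Circle) :
    Measure (I → Circle) :=
  (boltzmann pos α β Δ η univ)⁻¹ • boltzmann pos α β Δ η

/-- The specification `γ^{ω'}`: `γ_Δ(· | η)` conditioned on the event `[ω'_Δ]` that every spin in `Δ`
lies in the arc prescribed by `ω'`. -/
def constrainedSpec (pos : I → Site d) (α β : ℝ) (q : ℕ) [NeZero q] (ω' : I → Fin q)
    (Δ : Finset I) (η : I → Circle) : Measure (I → Circle) :=
  ProbabilityTheory.cond (gibbsSpec pos α β Δ η) {ω | ∀ x ∈ Δ, discretise q (ω x) = ω' x}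

/-- Gibbs measures (DLR equations) for a family `γ` of measures `γ_Δ(· | η)`. -/
def IsGibbs (γ : Finset I → (I → Circle) → Measure (I → Circle)) (μ : Measure (I → Circle)) :
    Prop :=
  IsProbabilityMeasure μ ∧
    ∀ (Δ : Finset I) (B : Set (I → Circle)), MeasurableSet B → ∫⁻ η, γ Δ η B ∂μ = μ B

/-! ### The discrete specification -/

/-- The family `γ^{ω'}|_{Λᶜ}` on the spins outside `Λ`, all interactions with `Λ` being dropped. -/
abbrev restrictedSpec (α β : ℝ) (q : ℕ) [NeZero q] (Λ : Finset (Site d))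
    (ω' : {x : Site d // x ∉ Λ} → Fin q) :
    Finset {x : Site d // x ∉ Λ} → ({x : Site d // x ∉ Λ} → Circle) →
      Measure ({x : Site d // x ∉ Λ} → Circle) :=
  constrainedSpec Subtype.val α β q ω'

open Classical in
/-- `μ_{Λᶜ}[ω'_{Λᶜ}]`: the unique Gibbs measure for `γ^{ω'}|_{Λᶜ}`
(by convention `0` if there is no unique one). -/
def constrainedGibbs (α β : ℝ) (q : ℕ) [NeZero q] (Λ : Finset (Site d))
    (ω' : {x : Site d // x ∉ Λ} → Fin q) : Measure ({x : Site d // x ∉ Λ} → Circle) :=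
  if h : ∃! μ, IsGibbs (restrictedSpec α β q Λ ω') μ then h.choose else 0

/-- The configuration on `ℤ^d` equal to `ζ` in `Λ` and to `ω` outside `Λ`. -/
def join (Λ : Finset (Site d)) (ζ : Λ → Circle) (ω : {x : Site d // x ∉ Λ} → Circle) :
    Site d → Circle :=
  fun x => if h : x ∈ Λ then ζ ⟨x, h⟩ else ω ⟨x, h⟩

/-- The discrete specification `γ'_Λ(ω'_Λ | ω'_{Λᶜ})`, as a function of `ω'`:
`μ_{Λᶜ}[ω'_{Λᶜ}](λ^Λ(exp(-β H_Λ) 1_{[ω'_Λ]})) / μ_{Λᶜ}[ω'_{Λᶜ}](λ^Λ(exp(-β H_Λ)))`. -/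
def discreteSpec (α β : ℝ) (q : ℕ) [NeZero q] (Λ : Finset (Site d)) (ω' : Site d → Fin q) : ℝ :=
  (∫ ω, ∫ ζ in {ζ : Λ → Circle | ∀ x, discretise q (ζ x) = ω' x},
      Real.exp (-β * hamiltonian id α Λ (join Λ ζ ω))
        ∂(Measure.pi fun _ : Λ => circleMeasure)
        ∂(constrainedGibbs α β q Λ fun x => ω' x)) /
  (∫ ω, ∫ ζ : Λ → Circle,
      Real.exp (-β * hamiltonian id α Λ (join Λ ζ ω))
        ∂(Measure.pi fun _ : Λ => circleMeasure)
        ∂(constrainedGibbs α β q Λ fun x => ω' x))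

/-! ### Regularity properties of a discrete specification

A discrete specification is given through the numbers `γ Λ η = γ_Λ(η_Λ | η_{Λᶜ})`. -/

/-- `γ_{Λ+i}` at the configuration translated by `i` equals `γ_Λ` at the original configuration. -/
def IsTranslationInvariant {E : Type} (γ : Finset (Site d) → (Site d → E) → ℝ) : Prop :=
  ∀ (Λ : Finset (Site d)) (i : Site d) (η : Site d → E),
    γ (Λ.map (Equiv.addRight i).toEmbedding) (fun x => η (x - i)) = γ Λ η

def IsNonnull {E : Type} (γ : Finset (Site d) → (Site d → E) → ℝ) : Prop :=
  ∃ δ : ℝ, 0 < δ ∧ ∀ η : Site d → E, δ ≤ γ {0} η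

/-- The oscillation `δ_x(f)`, with values in `[0, ∞]`. -/
def oscillation {E : Type} (x : Site d) (f : (Site d → E) → ℝ) : ENNReal :=
  ⨆ (η : Site d → E) (ξ : Site d → E) (_ : ∀ y, y ≠ x → η y = ξ y), ENNReal.ofReal |f η - f ξ|

end

end LongRangeXY

/-! The theorem is an application of Dobrushin's uniqueness theory. Conditioning every spin to lie
in an arc of length `2π/q` weakens the influence of one spin on another. Write `J(x, y) = |x -
y|^{-α}`. If the boundary spin at `y` changes from `η_y` to `ξ_y`, the logarithm of the ratio of the
two Boltzmann weights at `x` is, up to a constant, `β J(x, y) s · (η_y - ξ_y)` as a function of the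
spin `s` at `x`. Over one arc this oscillates by at most `D = 4 |β| π J(x, y) / q`, since a chord of
the arc has length at most `2π/q` and `|η_y - ξ_y| ≤ 2`.

Two probability laws whose log density ratio oscillates by at most `D` give expectations that differ
by at most `D / 4` times the oscillation of the test function (`abs_integral_div_sub_le`). So `C(x,
y) = |β| π J(x, y) / q` bounds the interdependence matrix (`isDobrushin_specAverage`). The
hypothesis on `q` says exactly that the row sums of `C` are bounded by some `c < 1`, uniformly in
`Λ` and in the constraint.

Existence of a Gibbs measure follows from compactness and consistency (`exists_isGibbs`). Uniqueness
and quantitative stability both come from one comparison theorem (`IsDobrushin.le_tsum`). Changing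
the constraint at the site `x` changes the expectation of `f` by at most `2 ∑_y G(y, x) δ_y(f)`,
where `G = ∑ Cⁿ`.

Translation invariance is then uniqueness applied to a translated Gibbs measure, and nonnullness
follows from boundedness of the one-site Hamiltonian. For the oscillations, the numerator and the
denominator of the discretised kernel at `0` integrate functions whose oscillation at `y` is at most
a constant times `J(0, y)`. Summing `G(y, x) J(0, y)` over `x` first costs a factor `(1 - c)⁻¹`, and
the couplings at `0` are summable because `α > d`. -/

namespace LongRangeXY

open MeasureTheory Set Filter Topology
open scoped ENNReal

/-! ### Oscillations of functions on a product space -/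

section Oscillation

variable {I E : Type*}

/-- The oscillation of `f` at the site `x`, with values in `[0, ∞]`. -/
noncomputable def siteOsc (x : I) (f : (I → E) → ℝ) : ℝ≥0∞ :=
  ⨆ (η : I → E) (ξ : I → E) (_ : ∀ y, y ≠ x → η y = ξ y), ENNReal.ofReal |f η - f ξ|

theorem le_siteOsc {x : I} (f : (I → E) → ℝ) {η ξ : I → E} (h : ∀ y, y ≠ x → η y = ξ y) :
    ENNReal.ofReal |f η - f ξ| ≤ siteOsc x f :=
  le_iSup_of_le η (le_iSup_of_le ξ (le_iSup_of_le h le_rfl))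

theorem siteOsc_le {x : I} {f : (I → E) → ℝ} {C : ℝ≥0∞}
    (h : ∀ η ξ : I → E, (∀ y, y ≠ x → η y = ξ y) → ENNReal.ofReal |f η - f ξ| ≤ C) :
    siteOsc x f ≤ C :=
  iSup_le fun η => iSup_le fun ξ => iSup_le fun hh => h η ξ hh

theorem ofReal_abs_sub_triangle (a b c : ℝ) :
    ENNReal.ofReal |a - c| ≤ ENNReal.ofReal |a - b| + ENNReal.ofReal |b - c| := by
  rw [← ENNReal.ofReal_add (abs_nonneg _) (abs_nonneg _)]
  exact ENNReal.ofReal_le_ofReal (abs_sub_le a b c)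

/-- Telescoping: the sites of `F` are switched from `η` to `ξ` one at a time. -/
theorem ofReal_abs_sub_le_sum_siteOsc [DecidableEq I] (f : (I → E) → ℝ) (F : Finset I) :
    ∀ η ξ : I → E, (∀ y, y ∉ F → η y = ξ y) →
      ENNReal.ofReal |f η - f ξ| ≤ ∑ x ∈ F, siteOsc x f := by
  induction F using Finset.induction_on with
  | empty =>
    intro η ξ h
    have : η = ξ := funext fun y => h y (Finset.notMem_empty y)
    simp [this]
  | insert x F hx ih =>
    intro η ξ h
    rw [Finset.sum_insert hx]
    refine (ofReal_abs_sub_triangle _ (f (Function.update η x (ξ x))) _).trans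
      (add_le_add (le_siteOsc f fun y hy => by simp [hy]) (ih _ _ fun y hy => ?_))
    by_cases hyx : y = x
    · subst hyx; simp
    · simp [hyx, h y (by simp [hyx, hy])]

/-- Switching only finitely many sites approximates `ξ` in the product topology, so continuity
carries the telescoping bound to the limit. -/
theorem ofReal_abs_sub_le_tsum_siteOsc [TopologicalSpace E] {f : (I → E) → ℝ}
    (hf : Continuous f) (η ξ : I → E) :
    ENNReal.ofReal |f η - f ξ| ≤ ∑' x, siteOsc x f := by
  classical
  have hlim : Tendsto (fun F : Finset I => fun y => if y ∈ F then ξ y else η y) atTop (𝓝 ξ) := by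
    refine tendsto_pi_nhds.2 fun y => tendsto_const_nhds.congr' ?_
    filter_upwards [eventually_ge_atTop {y}] with F hF
    rw [if_pos (hF (Finset.mem_singleton_self y))]
  have h2 : Tendsto (fun F : Finset I => ENNReal.ofReal
      |f η - f (fun y => if y ∈ F then ξ y else η y)|) atTop (𝓝 (ENNReal.ofReal |f η - f ξ|)) :=
    (ENNReal.continuous_ofReal.tendsto _).comp
      ((tendsto_const_nhds.sub ((hf.tendsto ξ).comp hlim)).abs)
  refine le_of_tendsto h2 (Eventually.of_forall fun F => ?_)
  exact (ofReal_abs_sub_le_sum_siteOsc f F _ _ fun y hy => by simp [hy]).trans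
    (ENNReal.sum_le_tsum F)

/-- The crude a priori bound from which the iteration of the comparison theorem starts; the measures
need no relation to each other. -/
theorem ofReal_abs_integral_sub_integral_le [TopologicalSpace E] [MeasurableSpace (I → E)]
    [OpensMeasurableSpace (I → E)] [CompactSpace E]
    (μ ν : Measure (I → E)) [IsProbabilityMeasure μ] [IsProbabilityMeasure ν] {f : (I → E) → ℝ}
    (hf : Continuous f) :
    ENNReal.ofReal |∫ η, f η ∂μ - ∫ η, f η ∂ν| ≤ ∑' x, siteOsc x f := by
  rcases eq_or_ne (∑' x, siteOsc x f) ⊤ with htop | htop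
  · simp [htop]
  set K := (∑' x, siteOsc x f).toReal with hK
  have hosc : ∀ η ξ, f η - f ξ ≤ K := fun η ξ =>
    (le_abs_self _).trans ((ENNReal.ofReal_le_iff_le_toReal htop).1
      (ofReal_abs_sub_le_tsum_siteOsc hf η ξ))
  have hint : ∀ ρ : Measure (I → E), IsProbabilityMeasure ρ → Integrable f ρ := fun ρ _ =>
    hf.integrable_of_hasCompactSupport (HasCompactSupport.of_compactSpace f)
  have key : ∀ ρ σ : Measure (I → E), IsProbabilityMeasure ρ → IsProbabilityMeasure σ →
      ∫ η, f η ∂ρ - ∫ η, f η ∂σ ≤ K := by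
    intro ρ σ _ _
    have h1 : ∀ ξ, ∫ η, f η ∂ρ ≤ f ξ + K := fun ξ => by
      have := integral_mono (hint ρ inferInstance) (integrable_const (f ξ + K))
        fun η => by linarith [hosc η ξ]
      simpa using this
    have h2 := integral_mono (integrable_const (∫ η, f η ∂ρ))
      ((hint σ inferInstance).add (integrable_const K)) fun ξ => h1 ξ
    rw [integral_add' (hint σ inferInstance) (integrable_const K)] at h2
    simp at h2
    linarith
  rw [ENNReal.ofReal_le_iff_le_toReal htop, abs_sub_le_iff]
  exact ⟨key μ ν inferInstance inferInstance, key ν μ inferInstance inferInstance⟩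

end Oscillation

/-! ### The Dobrushin comparison theorem -/

section Comparison

variable {I E : Type*} [DecidableEq I] [TopologicalSpace E]

/-- A family of single-site operators on continuous functions which satisfies Dobrushin's
condition with interdependence matrix `C`, whose rows sum to at most `c`. -/
structure IsDobrushin (G : I → ((I → E) → ℝ) → (I → E) → ℝ) (C : I → I → ℝ≥0∞) (c : ℝ≥0∞) :
    Prop where
  continuous : ∀ x f, Continuous f → Continuous (G x f)
  siteOsc_self : ∀ x f, Continuous f → siteOsc x (G x f) = 0
  siteOsc_of_ne : ∀ x y f, Continuous f → y ≠ x →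
    siteOsc y (G x f) ≤ siteOsc y f + C x y * siteOsc x f
  tsum_le : ∀ x, ∑' y, C x y ≤ c

variable {G : I → ((I → E) → ℝ) → (I → E) → ℝ} {C : I → I → ℝ≥0∞} {c : ℝ≥0∞}

/-- Weighted oscillations do not increase under `G x` when the weight at `x` dominates. -/
theorem IsDobrushin.tsum_mul_siteOsc_add_le (hG : IsDobrushin G C c) {f : (I → E) → ℝ}
    (hf : Continuous f) (x : I) {w w' : I → ℝ≥0∞} {b : ℝ≥0∞} (hw : ∀ y, y ≠ x → w y ≤ w' y)
    (hx : b + ∑' y, C x y * w y ≤ w' x) :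
    ∑' y, w y * siteOsc y (G x f) + b * siteOsc x f ≤ ∑' y, w' y * siteOsc y f := by
  -- The term at `x` drops out because `G x f` does not depend on the spin there; this frees the
  -- whole budget `w' x` for the influence that `x` passes on to the other sites.
  have h1 : ∀ y, w y * siteOsc y (G x f) ≤
      (if y = x then 0 else w' y * siteOsc y f) + C x y * w y * siteOsc x f := by
    intro y
    by_cases hy : y = x
    · subst hy; simp [hG.siteOsc_self y f hf]
    · rw [if_neg hy]
      calc w y * siteOsc y (G x f) ≤ w y * (siteOsc y f + C x y * siteOsc x f) := by
            gcongr; exact hG.siteOsc_of_ne x y f hf hy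
        _ = w y * siteOsc y f + C x y * w y * siteOsc x f := by ring
        _ ≤ _ := by gcongr; exact hw y hy
  have h2 : ∑' y, w' y * siteOsc y f =
      w' x * siteOsc x f + ∑' y, if y = x then 0 else w' y * siteOsc y f := by
    convert ENNReal.tsum_eq_add_tsum_ite x
  calc _ ≤ ∑' y, ((if y = x then 0 else w' y * siteOsc y f) + C x y * w y * siteOsc x f)
        + b * siteOsc x f := by gcongr with y; exact h1 y
    _ = (∑' y, if y = x then 0 else w' y * siteOsc y f)
        + (b + ∑' y, C x y * w y) * siteOsc x f := by
        rw [ENNReal.tsum_add, ENNReal.tsum_mul_right]; ring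
    _ ≤ (∑' y, if y = x then 0 else w' y * siteOsc y f) + w' x * siteOsc x f := by gcongr
    _ = _ := by rw [h2, add_comm]

/-- Abstract form of the Dobrushin comparison theorem. -/
theorem IsDobrushin.le_tsum (hG : IsDobrushin G C c) (hc : c < 1)
    {D : ((I → E) → ℝ) → ℝ≥0∞} (hD : ∀ f, Continuous f → D f ≤ ∑' x, siteOsc x f)
    {a b : I → ℝ≥0∞} (hDG : ∀ x f, Continuous f → D f ≤ D (G x f) + b x * siteOsc x f)
    (ha : ∀ x, b x + ∑' y, C x y * a y ≤ a x)
    {f : (I → E) → ℝ} (hf : Continuous f) (hfin : ∑' x, siteOsc x f ≠ ⊤) :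
    D f ≤ ∑' x, a x * siteOsc x f := by
  -- One sweep: `g` is `f` resampled at every site of `F` in some order. The target inequality with
  -- slack `t` pulls back from `g` to `f` since `a` is a supersolution of `b + C a ≤ a`, and each
  -- swept site has its oscillation weight reduced to `c`.
  have step : ∀ (F : Finset I) (f : (I → E) → ℝ), Continuous f → ∃ g, Continuous g ∧
      (∀ t, D g ≤ ∑' x, a x * siteOsc x g + t → D f ≤ ∑' x, a x * siteOsc x f + t) ∧
      ∑' x, siteOsc x g ≤ ∑' x, (if x ∈ F then c else 1) * siteOsc x f := by
    intro F
    induction F using Finset.induction_on with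
    | empty => exact fun f hf => ⟨f, hf, fun t h => h, by simp⟩
    | insert x F hx ih =>
      intro f hf
      obtain ⟨g, hg, ht, hs⟩ := ih (G x f) (hG.continuous x f hf)
      refine ⟨g, hg, fun t h => ?_, hs.trans ?_⟩
      · calc D f ≤ D (G x f) + b x * siteOsc x f := hDG x f hf
          _ ≤ ∑' y, a y * siteOsc y (G x f) + t + b x * siteOsc x f := by gcongr; exact ht t h
          _ = (∑' y, a y * siteOsc y (G x f) + b x * siteOsc x f) + t := by ring
          _ ≤ _ := by
            gcongr
            exact hG.tsum_mul_siteOsc_add_le hf x (fun _ _ => le_rfl) (ha x)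
      · refine le_trans le_self_add (hG.tsum_mul_siteOsc_add_le (b := 0)
          (w := fun y => if y ∈ F then c else 1)
          (w' := fun y => if y ∈ insert x F then c else 1) hf x (fun y hy => ?_) ?_)
        · simp [hy]
        · rw [zero_add, if_pos (Finset.mem_insert_self x F)]
          refine le_trans (ENNReal.tsum_le_tsum fun y => ?_) (hG.tsum_le x)
          split_ifs
          · exact mul_le_of_le_one_right' hc.le
          · simp
  -- The slack after `n` sweeps. A single sweep covers only a finite set, so each induction step
  -- leaves the oscillation outside `F` as an error, removed by letting `F` exhaust the sites.
  have main : ∀ n : ℕ, ∀ f, Continuous f → ∑' x, siteOsc x f ≠ ⊤ →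
      D f ≤ ∑' x, a x * siteOsc x f + c ^ n * ∑' x, siteOsc x f := by
    intro n
    induction n with
    | zero => exact fun f hf _ => by simpa using (hD f hf).trans le_add_self
    | succ n ih =>
      intro f hf hfin
      have hF : ∀ F : Finset I, D f ≤ ∑' x, a x * siteOsc x f +
          c ^ n * (c * ∑' x, siteOsc x f + ∑' x : {x // x ∉ F}, siteOsc x.1 f) := by
        intro F
        obtain ⟨g, hg, ht, hs⟩ := step F f hf
        have hs' : ∑' x, siteOsc x g ≤
            c * ∑' x, siteOsc x f + ∑' x : {x // x ∉ F}, siteOsc x.1 f := by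
          refine hs.trans ?_
          have : ∑' x : {x // x ∉ F}, siteOsc x.1 f =
              ∑' x, ({x | x ∉ F} : Set I).indicator (fun x => siteOsc x f) x :=
            tsum_subtype {x | x ∉ F} fun x => siteOsc x f
          rw [this, ← ENNReal.tsum_mul_left, ← ENNReal.tsum_add]
          refine ENNReal.tsum_le_tsum fun x => ?_
          by_cases hx : x ∈ F <;> simp [hx]
        have hs'' : ∑' x, siteOsc x g ≠ ⊤ := by
          refine ne_top_of_le_ne_top hfin (hs.trans (ENNReal.tsum_le_tsum fun x => ?_))
          split_ifs
          · exact mul_le_of_le_one_left' hc.le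
          · simp
        refine ht _ ((ih g hg hs'').trans ?_)
        gcongr
      have hlim : Tendsto (fun F : Finset I => ∑' x, a x * siteOsc x f +
          c ^ n * (c * ∑' x, siteOsc x f + ∑' x : {x // x ∉ F}, siteOsc x.1 f)) atTop
          (𝓝 (∑' x, a x * siteOsc x f + c ^ n * (c * ∑' x, siteOsc x f + 0))) := by
        refine tendsto_const_nhds.add (ENNReal.Tendsto.const_mul (tendsto_const_nhds.add
          (ENNReal.tendsto_tsum_compl_atTop_zero hfin)) (Or.inr ?_))
        exact ENNReal.pow_ne_top hc.ne_top
      have := ge_of_tendsto' hlim hF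
      rwa [add_zero, ← mul_assoc, ← pow_succ] at this
  have hlim : Tendsto (fun n : ℕ => ∑' x, a x * siteOsc x f + c ^ n * ∑' x, siteOsc x f) atTop
      (𝓝 (∑' x, a x * siteOsc x f + 0 * ∑' x, siteOsc x f)) :=
    tendsto_const_nhds.add (ENNReal.Tendsto.mul_const
      (ENNReal.tendsto_pow_atTop_nhds_zero_of_lt_one hc) (Or.inr hfin))
  have := ge_of_tendsto' hlim fun n => main n f hf hfin
  simpa using this

end Comparison

/-! ### Powers of the interdependence matrix -/

section MatrixPowers

variable {I : Type*} [DecidableEq I] (C : I → I → ℝ≥0∞)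

/-- The powers of a matrix with entries in `[0, ∞]`. -/
noncomputable def matPow : ℕ → I → I → ℝ≥0∞
  | 0 => fun y x => if y = x then 1 else 0
  | n + 1 => fun y x => ∑' z, C y z * matPow n z x

/-- The sum `∑ Cⁿ`. -/
noncomputable def matGreen (y x : I) : ℝ≥0∞ := ∑' n, matPow C n y x

/-- The resolvent identity `G = 1 + C G`: each column of `G` solves the equation that the comparison
theorem asks of the weight `a`, with a source at one site. -/
theorem matGreen_eq (y x : I) :
    matGreen C y x = (if y = x then 1 else 0) + ∑' z, C y z * matGreen C z x := by
  rw [matGreen, tsum_eq_zero_add' ENNReal.summable]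
  simp only [matPow, matGreen]
  rw [ENNReal.tsum_comm]
  simp only [ENNReal.tsum_mul_left]

/-- Row sums of `Cⁿ` are at most `cⁿ`; the bound is their geometric series. -/
theorem tsum_matGreen_le {c : ℝ≥0∞} (hC : ∀ x, ∑' y, C x y ≤ c) (y : I) :
    ∑' x, matGreen C y x ≤ (1 - c)⁻¹ := by
  have hpow : ∀ n y, ∑' x, matPow C n y x ≤ c ^ n := by
    intro n
    induction n with
    | zero => intro y; simp [matPow]
    | succ n ih =>
      intro y
      simp only [matPow]
      rw [ENNReal.tsum_comm]
      simp only [ENNReal.tsum_mul_left]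
      calc ∑' z, C y z * ∑' x, matPow C n z x ≤ ∑' z, C y z * c ^ n := by
            gcongr with z; exact ih z
        _ ≤ c * c ^ n := by rw [ENNReal.tsum_mul_right]; gcongr; exact hC y
        _ = c ^ (n + 1) := by ring
  simp only [matGreen]
  rw [ENNReal.tsum_comm, ← ENNReal.tsum_geometric]
  exact ENNReal.tsum_le_tsum fun n => hpow n y

end MatrixPowers

/-! ### Comparison of two Gibbs factors on the same space -/

section GibbsFactors

/-- This is `tanh (s / 2) ≤ s / 2`. The difference of the two sides vanishes at `0` and has
derivative `1 - (1 - t) eᵗ`, which is nonnegative because `1 - t ≤ e⁻ᵗ`. -/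
theorem two_mul_exp_sub_one_le {s : ℝ} (hs : 0 ≤ s) :
    2 * (Real.exp s - 1) ≤ s * (Real.exp s + 1) := by
  have hd : ∀ t : ℝ, HasDerivAt (fun t => t * (Real.exp t + 1) - 2 * (Real.exp t - 1))
      (1 * (Real.exp t + 1) + t * Real.exp t - 2 * Real.exp t) t := fun t =>
    ((hasDerivAt_id t).mul ((Real.hasDerivAt_exp t).add_const 1)).sub
      (((Real.hasDerivAt_exp t).sub_const 1).const_mul 2)
  have hmono : MonotoneOn (fun t => t * (Real.exp t + 1) - 2 * (Real.exp t - 1)) (Ici 0) := by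
    refine monotoneOn_of_deriv_nonneg (convex_Ici 0)
      (fun t _ => (hd t).continuousAt.continuousWithinAt)
      (fun t _ => (hd t).differentiableAt.differentiableWithinAt) fun t _ => ?_
    rw [(hd t).deriv]
    have h1 : 1 - t ≤ Real.exp (-t) := by linarith [Real.add_one_le_exp (-t)]
    have h2 : (1 - t) * Real.exp t ≤ Real.exp (-t) * Real.exp t :=
      mul_le_mul_of_nonneg_right h1 (Real.exp_pos t).le
    rw [← Real.exp_add, neg_add_cancel, Real.exp_zero] at h2
    linarith
  have := hmono (mem_Ici.2 le_rfl) (mem_Ici.2 hs) hs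
  simp at this
  linarith

/-- Two numbers of `[0, 1]` whose odds differ at most by the factor `exp D` have distance at
most `D / 4`. -/
theorem sub_le_of_odds {x y D : ℝ} (hx0 : 0 ≤ x) (hx1 : x ≤ 1) (hy0 : 0 ≤ y) (hy1 : y ≤ 1)
    (hD : 0 ≤ D) (h : y * (1 - x) ≤ Real.exp D * (x * (1 - y))) : y - x ≤ D / 4 := by
  -- With `p² = y(1 - x)` and `s² = x(1 - y)` one has `y - x = (p - s)(p + s)`. The odds bound is `p
  -- ≤ r s`, so `p - s ≤ (r - 1)/(r + 1) · (p + s)`, and the prefactor is `tanh (D / 4)`.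
  set r := Real.exp (D / 2) with hr
  have hr1 : 1 ≤ r := Real.one_le_exp (by positivity)
  have hrr : Real.exp D = r ^ 2 := by rw [hr, ← Real.exp_nat_mul]; congr 1; push_cast; ring
  have hP0 : 0 ≤ y * (1 - x) := mul_nonneg hy0 (by linarith)
  have hQ0 : 0 ≤ x * (1 - y) := mul_nonneg hx0 (by linarith)
  set p := Real.sqrt (y * (1 - x)) with hp
  set s := Real.sqrt (x * (1 - y)) with hs
  have hp2 : p ^ 2 = y * (1 - x) := Real.sq_sqrt hP0
  have hs2 : s ^ 2 = x * (1 - y) := Real.sq_sqrt hQ0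
  have hp0 : 0 ≤ p := Real.sqrt_nonneg _
  have hs0 : 0 ≤ s := Real.sqrt_nonneg _
  have hps : p ≤ r * s := by
    refine le_of_sq_le_sq ?_ (by positivity)
    rw [mul_pow, hp2, hs2, ← hrr]; exact h
  -- Regrouping `p s` as `√(x(1 - x)) √(y(1 - y))` and using the inequality of arithmetic and
  -- geometric means bounds the square by `1 - (x + y - 1)²`.
  have hsum : (p + s) ^ 2 ≤ 1 := by
    have hmul : p * s ≤ (x * (1 - x) + y * (1 - y)) / 2 := by
      have : p * s = Real.sqrt (x * (1 - x)) * Real.sqrt (y * (1 - y)) := by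
        rw [hp, hs, ← Real.sqrt_mul hP0, ← Real.sqrt_mul (mul_nonneg hx0 (by linarith))]
        congr 1; ring
      rw [this]
      have h1 := Real.sq_sqrt (mul_nonneg hx0 (show 0 ≤ 1 - x by linarith))
      have h2 := Real.sq_sqrt (mul_nonneg hy0 (show 0 ≤ 1 - y by linarith))
      nlinarith [sq_nonneg (Real.sqrt (x * (1 - x)) - Real.sqrt (y * (1 - y)))]
    nlinarith [sq_nonneg (x + y - 1)]
  have h1 : (r + 1) * (p - s) ≤ (r - 1) * (p + s) := by nlinarith
  have h2 : (r + 1) * (y - x) ≤ r - 1 := by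
    have : y - x = (p - s) * (p + s) := by nlinarith
    rw [this]
    calc (r + 1) * ((p - s) * (p + s)) = ((r + 1) * (p - s)) * (p + s) := by ring
      _ ≤ ((r - 1) * (p + s)) * (p + s) := by gcongr
      _ = (r - 1) * (p + s) ^ 2 := by ring
      _ ≤ r - 1 := mul_le_of_le_one_right (by linarith) hsum
  have h3 := two_mul_exp_sub_one_le (show 0 ≤ D / 2 by positivity)
  rw [← hr] at h3
  nlinarith

variable {S : Type*} [MeasurableSpace S] {m : Measure S}

/-- Multiplying the two-point bound by `g s (1 - g t)` and integrating over both variables compares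
the odds of the two expectations of `g`; then `sub_le_of_odds` applies. The bound is needed only
almost everywhere, so spins outside the prescribed arc can be ignored. -/
theorem abs_integral_div_sub_le_of_mem_Icc {g u v : S → ℝ} {D : ℝ} (hD : 0 ≤ D)
    (hg : Measurable g) (hg01 : ∀ s, g s ∈ Icc (0 : ℝ) 1)
    (hu : Integrable u m) (hv : Integrable v m) (hu0 : ∀ s, 0 ≤ u s) (hv0 : ∀ s, 0 ≤ v s)
    (hU : 0 < ∫ s, u s ∂m) (hV : 0 < ∫ s, v s ∂m)
    (h : ∀ᵐ s ∂m, ∀ᵐ t ∂m, v s * u t ≤ Real.exp D * (u s * v t)) :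
    (∫ s, g s * v s ∂m) / (∫ s, v s ∂m) - (∫ s, g s * u s ∂m) / (∫ s, u s ∂m) ≤ D / 4 := by
  have hgi : ∀ w : S → ℝ, Integrable w m → Integrable (fun s => g s * w s) m := fun w hw =>
    hw.bdd_mul (c := 1) hg.aestronglyMeasurable (Eventually.of_forall fun s => by
      rw [Real.norm_eq_abs, abs_of_nonneg (hg01 s).1]; exact (hg01 s).2)
  have hgu := hgi u hu
  have hgv := hgi v hv
  have hle : ∀ w : S → ℝ, Integrable w m → (∀ s, 0 ≤ w s) →
      0 ≤ ∫ s, g s * w s ∂m ∧ ∫ s, g s * w s ∂m ≤ ∫ s, w s ∂m := fun w hw hw0 =>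
    ⟨integral_nonneg fun s => mul_nonneg (hg01 s).1 (hw0 s),
      integral_mono (hgi w hw) hw fun s => mul_le_of_le_one_left (hw0 s) (hg01 s).2⟩
  have key : (∫ s, g s * v s ∂m) * (∫ t, u t ∂m - ∫ t, g t * u t ∂m) ≤
      Real.exp D * ((∫ s, g s * u s ∂m) * (∫ t, v t ∂m - ∫ t, g t * v t ∂m)) := by
    rw [← integral_sub hu hgu, ← integral_sub hv hgv, ← integral_mul_const, ← mul_assoc,
      ← integral_const_mul (Real.exp D), ← integral_mul_const]
    refine integral_mono_ae (hgv.mul_const _) ((hgu.const_mul _).mul_const _) ?_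
    filter_upwards [h] with s hs
    have : v s * ∫ t, u t - g t * u t ∂m ≤ Real.exp D * u s * ∫ t, v t - g t * v t ∂m := by
      rw [← integral_const_mul, ← integral_const_mul]
      refine integral_mono_ae ((hu.sub hgu).const_mul _) ((hv.sub hgv).const_mul _) ?_
      filter_upwards [hs] with t ht
      have := mul_le_mul_of_nonneg_left ht (show 0 ≤ 1 - g t by linarith [(hg01 t).2])
      calc _ = (1 - g t) * (v s * u t) := by ring
        _ ≤ _ := this
        _ = _ := by ring
    have := mul_le_mul_of_nonneg_left this (hg01 s).1
    calc _ = g s * (v s * ∫ t, u t - g t * u t ∂m) := by ring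
      _ ≤ _ := this
      _ = _ := by ring
  obtain ⟨hgu0, hgu1⟩ := hle u hu hu0
  obtain ⟨hgv0, hgv1⟩ := hle v hv hv0
  refine sub_le_of_odds (by positivity) ((div_le_one hU).2 hgu1) (by positivity)
    ((div_le_one hV).2 hgv1) hD ?_
  rw [one_sub_div hU.ne', one_sub_div hV.ne', div_mul_div_comm, div_mul_div_comm, mul_div_assoc',
    mul_comm (∫ s, u s ∂m) (∫ s, v s ∂m)]
  gcongr

/-- If the logarithm of the ratio of two weights oscillates at most by `D`, then the expectations
of `g` under the two normalised weights differ at most by `D / 4` times the oscillation of `g`. -/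
theorem abs_integral_div_sub_le {g u v : S → ℝ} {D K : ℝ} (hD : 0 ≤ D)
    (hg : Measurable g) (hgK : ∀ s t, |g s - g t| ≤ K)
    (hu : Integrable u m) (hv : Integrable v m) (hu0 : ∀ s, 0 ≤ u s) (hv0 : ∀ s, 0 ≤ v s)
    (hU : 0 < ∫ s, u s ∂m) (hV : 0 < ∫ s, v s ∂m)
    (h : ∀ᵐ s ∂m, ∀ᵐ t ∂m, v s * u t ≤ Real.exp D * (u s * v t)) :
    |(∫ s, g s * v s ∂m) / (∫ s, v s ∂m) - (∫ s, g s * u s ∂m) / (∫ s, u s ∂m)| ≤ D / 4 * K := by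
  rcases isEmpty_or_nonempty S with hS | ⟨⟨s₀⟩⟩
  · simp [Measure.eq_zero_of_isEmpty m] at hU
  have hK : 0 ≤ K := (abs_nonneg _).trans (hgK s₀ s₀)
  set a := ⨅ s, g s with ha
  have hbdd : BddBelow (range g) := ⟨g s₀ - K, by
    rintro _ ⟨s, rfl⟩; linarith [(abs_le.1 (hgK s₀ s)).2]⟩
  have hlo : ∀ s, a ≤ g s := fun s => ciInf_le hbdd s
  have hhi : ∀ s, g s ≤ a + K := fun s => by
    have : g s - K ≤ a := by
      have : Nonempty S := ⟨s₀⟩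
      exact le_ciInf fun t => by linarith [(abs_le.1 (hgK s t)).2]
    linarith
  -- A constant `g` is treated apart, since the reduction to values in `[0, 1]` divides by `K`.
  rcases hK.eq_or_lt with hK0 | hK0
  · have : ∀ s, g s = a := fun s => le_antisymm (by linarith [hhi s]) (hlo s)
    simp only [this, integral_const_mul]
    rw [mul_div_cancel_right₀ _ hU.ne', mul_div_cancel_right₀ _ hV.ne', ← hK0]; simp
  have hscale : ∀ w : S → ℝ, Integrable w m → 0 < ∫ s, w s ∂m →
      (∫ s, g s * w s ∂m) / ∫ s, w s ∂m =
        a + K * ((∫ s, (g s - a) / K * w s ∂m) / ∫ s, w s ∂m) := by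
    intro w hw hW
    have h1 : Integrable (fun s => (g s - a) / K * w s) m :=
      hw.bdd_mul (c := 1) ((hg.sub_const a).div_const K).aestronglyMeasurable
        (Eventually.of_forall fun s => by
          rw [Real.norm_eq_abs, abs_of_nonneg (div_nonneg (by linarith [hlo s]) hK),
            div_le_one hK0]; linarith [hhi s])
    have h2 : ∫ s, g s * w s ∂m = a * ∫ s, w s ∂m + K * ∫ s, (g s - a) / K * w s ∂m := by
      rw [← integral_const_mul, ← integral_const_mul, ← integral_add (hw.const_mul a)
        (h1.const_mul K)]
      congr 1; ext s; field_simp; ring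
    rw [h2]; field_simp
  have hmeas : Measurable fun s => (g s - a) / K := (hg.sub_const a).div_const K
  have h01 : ∀ s, (g s - a) / K ∈ Icc (0 : ℝ) 1 := fun s =>
    ⟨div_nonneg (by linarith [hlo s]) hK, (div_le_one hK0).2 (by linarith [hhi s])⟩
  have hmeas' : Measurable fun s => 1 - (g s - a) / K := measurable_const.sub hmeas
  have h01' : ∀ s, 1 - (g s - a) / K ∈ Icc (0 : ℝ) 1 := fun s =>
    ⟨by linarith [(h01 s).2], by linarith [(h01 s).1]⟩
  have e1 := abs_integral_div_sub_le_of_mem_Icc hD hmeas h01 hu hv hu0 hv0 hU hV h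
  -- The hypothesis is kept as it is and `g` is replaced by its complement; this gives the opposite
  -- sign.
  have e2 := abs_integral_div_sub_le_of_mem_Icc hD hmeas' h01' hu hv hu0 hv0 hU hV h
  have hcompl : ∀ w : S → ℝ, Integrable w m → 0 < ∫ s, w s ∂m →
      (∫ s, (1 - (g s - a) / K) * w s ∂m) / ∫ s, w s ∂m =
        1 - (∫ s, (g s - a) / K * w s ∂m) / ∫ s, w s ∂m := by
    intro w hw hW
    have h1 : Integrable (fun s => (g s - a) / K * w s) m :=
      hw.bdd_mul (c := 1) hmeas.aestronglyMeasurable (Eventually.of_forall fun s => by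
          rw [Real.norm_eq_abs, abs_of_nonneg (h01 s).1]; exact (h01 s).2)
    simp only [sub_mul, one_mul]
    rw [integral_sub hw h1, sub_div, div_self hW.ne']
  rw [hcompl u hu hU, hcompl v hv hV] at e2
  rw [hscale u hu hU, hscale v hv hV, add_sub_add_left_eq_sub, ← mul_sub, abs_mul,
    abs_of_pos hK0, mul_comm]
  gcongr
  rw [abs_le]
  constructor <;> linarith

end GibbsFactors

/-! ### The circle -/

section CircleFacts

theorem exp_angle (z : Circle) : Circle.exp (angle z) = z := by
  have h : angle z = Complex.arg z - toIcoDiv Real.two_pi_pos 0 (Complex.arg z) • (2 * Real.pi) :=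
    rfl
  rw [h, zsmul_eq_mul, Circle.exp_sub, Circle.exp_int_mul_two_pi, div_one, Circle.exp_arg]

theorem angle_exp {θ : ℝ} (hθ : θ ∈ Ico (0 : ℝ) (2 * Real.pi)) : angle (Circle.exp θ) = θ := by
  rw [angle, Circle.coe_exp, Complex.arg_exp_mul_I]
  have : toIocMod Real.two_pi_pos (-Real.pi) θ =
    θ - toIocDiv Real.two_pi_pos (-Real.pi) θ • (2 * Real.pi) := rfl
  rw [this, toIcoMod_sub_zsmul, toIcoMod_eq_self]
  simpa using hθ

theorem measurable_angle : Measurable angle := by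
  have : angle = fun z : Circle =>
      Int.fract (Complex.arg (z : ℂ) / (2 * Real.pi)) * (2 * Real.pi) :=
    funext fun z => toIcoMod_eq_fract_mul _ _
  rw [this]
  have h : Measurable fun z : Circle => (z : ℂ) := by
    have hc : Continuous fun z : Circle => (z : ℂ) := by fun_prop
    exact hc.measurable
  exact (((Complex.measurable_arg.comp h).div_const _).fract).mul_const _

theorem measurableSet_discretise (q : ℕ) [NeZero q] (k : Fin q) :
    MeasurableSet {z : Circle | discretise q z = k} := by
  simp only [discretise_eq_iff]
  exact measurable_angle measurableSet_Ico

instance : IsFiniteMeasure circleMeasure := by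
  unfold circleMeasure
  infer_instance

theorem circleMeasure_discretise_pos (q : ℕ) [NeZero q] (k : Fin q) :
    0 < circleMeasure {z : Circle | discretise q z = k} := by
  have hq : (0 : ℝ) < q := Nat.cast_pos.mpr (NeZero.pos q)
  have hp := Real.pi_pos
  rw [circleMeasure, Measure.map_apply Circle.exp.continuous.measurable
    (measurableSet_discretise q k), Measure.restrict_apply
    (Circle.exp.continuous.measurable (measurableSet_discretise q k))]
  have hsub : Ico (2 * Real.pi * k / q) (2 * Real.pi * (k + 1) / q) ⊆
      Circle.exp ⁻¹' {z : Circle | discretise q z = k} ∩ Ico 0 (2 * Real.pi) := by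
    intro θ hθ
    have hk : ((k : ℕ) : ℝ) + 1 ≤ q := by exact_mod_cast k.isLt
    have hmem : θ ∈ Ico (0 : ℝ) (2 * Real.pi) := by
      refine ⟨le_trans (by positivity) hθ.1, hθ.2.trans_le ?_⟩
      rw [div_le_iff₀ hq]
      gcongr
    refine ⟨?_, hmem⟩
    simp only [mem_preimage, mem_ofPred_eq, discretise_eq_iff, angle_exp hmem]
    exact hθ
  refine lt_of_lt_of_le ?_ (measure_mono hsub)
  rw [Real.volume_Ico, ENNReal.ofReal_pos, sub_pos]
  gcongr
  linarith

theorem norm_coe_exp_sub_coe_exp_le (a b : ℝ) :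
    ‖(Circle.exp a : ℂ) - (Circle.exp b : ℂ)‖ ≤ |a - b| := by
  have h : (Circle.exp a : ℂ) - (Circle.exp b : ℂ) =
      Circle.exp b * (Complex.exp (Complex.I * ((a - b : ℝ) : ℂ)) - 1) := by
    rw [mul_sub, mul_one, Circle.coe_exp, Circle.coe_exp, ← Complex.exp_add]
    congr 2
    push_cast; ring
  rw [h, norm_mul, Circle.norm_coe, one_mul]
  exact Real.norm_exp_I_mul_ofReal_sub_one_le

/-- A chord is no longer than its arc. This is where a large `q` makes the constrained system weakly
dependent. -/
theorem norm_sub_le_of_discretise_eq (q : ℕ) [NeZero q] {z w : Circle}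
    (h : discretise q z = discretise q w) : ‖(z : ℂ) - (w : ℂ)‖ ≤ 2 * Real.pi / q := by
  have hz := (discretise_eq_iff q z _).1 h
  have hw := (discretise_eq_iff q w _).1 rfl
  have := norm_coe_exp_sub_coe_exp_le (angle z) (angle w)
  rw [exp_angle, exp_angle] at this
  refine this.trans ?_
  have e : 2 * Real.pi * ((discretise q w : ℕ) + 1) / q =
    2 * Real.pi * (discretise q w : ℕ) / q + 2 * Real.pi / (q : ℝ) := by ring
  rw [e] at hz hw
  rw [abs_le]
  constructor <;> linarith [hz.1, hz.2, hw.1, hw.2]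

theorem norm_coe_sub_coe_le_two (z w : Circle) : ‖(z : ℂ) - (w : ℂ)‖ ≤ 2 :=
  (norm_sub_le _ _).trans (by rw [Circle.norm_coe, Circle.norm_coe]; norm_num)

theorem abs_inner_coe_le_one (z w : Circle) : |inner ℝ (z : ℂ) (w : ℂ)| ≤ 1 :=
  (abs_real_inner_le_norm _ _).trans (by rw [Circle.norm_coe, Circle.norm_coe]; norm_num)

end CircleFacts

/-! ### The Hamiltonian -/

section Hamiltonian

variable {d : ℕ} {I : Type}

theorem siteNorm_nonneg (x : Site d) : 0 ≤ siteNorm x := Real.sqrt_nonneg _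

/-- The coupling `|x - y|^{-α}`. -/
noncomputable def coupling (pos : I → Site d) (α : ℝ) (x y : I) : ℝ :=
  siteNorm (pos x - pos y) ^ (-α)

theorem coupling_nonneg (pos : I → Site d) (α : ℝ) (x y : I) : 0 ≤ coupling pos α x y :=
  Real.rpow_nonneg (siteNorm_nonneg _) _

/-- The couplings at every site are summable. -/
def SummableCoupling (pos : I → Site d) (α : ℝ) : Prop :=
  ∀ x, Summable fun y => coupling pos α x y

variable (pos : I → Site d) (α : ℝ)

theorem continuous_potential (A : Finset I) : Continuous (potential pos α A) := by
  unfold potential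
  by_cases hA : A.card = 2
  · simp only [if_pos hA]
    fun_prop
  · simp only [if_neg hA]
    exact continuous_const

theorem potential_congr {A : Finset I} {ω ω' : I → Circle} (h : ∀ x ∈ A, ω x = ω' x) :
    potential pos α A ω = potential pos α A ω' := by
  unfold potential
  split_ifs
  · congr 1
    refine Finset.sum_congr rfl fun p hp => ?_
    rw [h _ (Finset.mem_offDiag.1 hp).1, h _ (Finset.mem_offDiag.1 hp).2.1]
  · rfl

/-- The supremum norm of the potential. -/
noncomputable def potentialBound (A : Finset I) : ℝ := potential pos α A fun _ => 1

theorem abs_potential_le (A : Finset I) (ω : I → Circle) :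
    |potential pos α A ω| ≤ potentialBound pos α A := by
  unfold potentialBound potential
  split_ifs
  · rw [abs_div, abs_two]
    gcongr
    refine (Finset.abs_sum_le_sum_abs _ _).trans (Finset.sum_le_sum fun p _ => ?_)
    rw [abs_mul, abs_of_nonneg (Real.rpow_nonneg (siteNorm_nonneg _) _)]
    refine mul_le_mul_of_nonneg_left ((abs_inner_coe_le_one _ _).trans ?_)
      (coupling_nonneg pos α p.1 p.2)
    simp
  · simp

theorem potentialBound_nonneg (A : Finset I) : 0 ≤ potentialBound pos α A :=
  (abs_nonneg _).trans (abs_potential_le pos α A fun _ => 1)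

variable [DecidableEq I]

theorem potentialBound_pair {x y : I} (h : x ≠ y) :
    potentialBound pos α {x, y} = coupling pos α x y := by
  rw [potentialBound, potential_pair pos α h, coupling]
  simp

theorem exists_eq_pair {A : Finset I} {x : I} (hx : x ∈ A) (hA : A.card = 2) :
    ∃ y, y ≠ x ∧ A = {x, y} := by
  obtain ⟨a, b, hab, rfl⟩ := Finset.card_eq_two.1 hA
  rcases Finset.mem_insert.1 hx with rfl | hx
  · exact ⟨b, hab.symm, rfl⟩
  · rw [Finset.mem_singleton] at hx
    subst hx
    exact ⟨a, hab, Finset.pair_comm _ _⟩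

variable {pos α}

/-- Only two-point sets `{x, y}` contribute, and `y ↦ {x, y}` is injective off `x`, so the sum over
sets is a sum of couplings at `x`. -/
theorem summable_potentialBound_of_mem (hs : SummableCoupling pos α) (x : I) :
    Summable fun A : Finset I => if x ∈ A then potentialBound pos α A else 0 := by
  have hinj : Function.Injective fun y : {y // y ≠ x} => ({x, y.1} : Finset I) := by
    intro y y' h
    have : y.1 ∈ ({x, y'.1} : Finset I) := by
      rw [← show ({x, y.1} : Finset I) = {x, y'.1} from h]; simp
    simp only [Finset.mem_insert, y.2, Finset.mem_singleton, false_or] at this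
    exact Subtype.ext this
  rw [← hinj.summable_iff]
  · refine ((hs x).subtype {y | y ≠ x}).congr fun y => ?_
    simp only [Function.comp_apply, Finset.mem_insert, true_or, if_true]
    exact (potentialBound_pair pos α (Ne.symm y.2)).symm
  · intro A hA
    by_cases hx : x ∈ A
    · rw [if_pos hx]
      by_cases hc : A.card = 2
      · obtain ⟨y, hy, rfl⟩ := exists_eq_pair hx hc
        exact absurd ⟨⟨y, hy⟩, rfl⟩ hA
      · rw [potentialBound, potential, if_neg hc]
    · rw [if_neg hx]

theorem summable_potentialBound (hs : SummableCoupling pos α) (Δ : Finset I) :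
    Summable fun A : {A : Finset I // (A ∩ Δ).Nonempty} => potentialBound pos α A := by
  have h1 : Summable fun A : Finset I =>
      ∑ x ∈ Δ, if x ∈ A then potentialBound pos α A else 0 :=
    summable_sum fun x _ => summable_potentialBound_of_mem hs x
  refine Summable.of_nonneg_of_le (fun A => potentialBound_nonneg pos α _) (fun A => ?_)
    (h1.subtype {A : Finset I | (A ∩ Δ).Nonempty})
  obtain ⟨x, hx⟩ := A.2
  rw [Finset.mem_inter] at hx
  have := Finset.single_le_sum (f := fun x => if x ∈ A.1 then potentialBound pos α A.1 else 0)
    (fun y _ => by split_ifs <;> simp [potentialBound_nonneg]) hx.2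
  simpa [hx.1] using this

theorem summable_potential (hs : SummableCoupling pos α) (Δ : Finset I) (ω : I → Circle) :
    Summable fun A : {A : Finset I // (A ∩ Δ).Nonempty} => potential pos α A ω :=
  (summable_potentialBound hs Δ).of_norm_bounded fun A => abs_potential_le pos α A ω

theorem continuous_hamiltonian (hs : SummableCoupling pos α) (Δ : Finset I) :
    Continuous (hamiltonian pos α Δ) :=
  continuous_tsum (fun A => continuous_potential pos α A.1) (summable_potentialBound hs Δ)
    fun A ω => abs_potential_le pos α A.1 ω

variable (pos α) in
/-- A bound for the Hamiltonian. -/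
noncomputable def hamiltonianBound (Δ : Finset I) : ℝ :=
  ∑' A : {A : Finset I // (A ∩ Δ).Nonempty}, potentialBound pos α A

theorem abs_hamiltonian_le (hs : SummableCoupling pos α) (Δ : Finset I) (ω : I → Circle) :
    |hamiltonian pos α Δ ω| ≤ hamiltonianBound pos α Δ :=
  tsum_of_norm_bounded (f := fun A : {A : Finset I // (A ∩ Δ).Nonempty} => potential pos α A ω)
    (summable_potentialBound hs Δ).hasSum fun A => abs_potential_le pos α A ω

/-- For configurations that agree off `Δ`, the energy difference is the same in every larger
volume. -/
theorem hamiltonian_sub_hamiltonian_eq (hs : SummableCoupling pos α) {Δ Δ' : Finset I}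
    (hΔ : Δ ⊆ Δ') {ω ω' : I → Circle}
    (h : ∀ x, x ∉ Δ → ω x = ω' x) :
    hamiltonian pos α Δ' ω - hamiltonian pos α Δ' ω' =
      hamiltonian pos α Δ ω - hamiltonian pos α Δ ω' := by
  have key : ∀ Δ'' : Finset I, Δ ⊆ Δ'' →
      hamiltonian pos α Δ'' ω - hamiltonian pos α Δ'' ω' =
        ∑' A : Finset I, (potential pos α A ω - potential pos α A ω') := by
    intro Δ'' hΔ''
    rw [hamiltonian, hamiltonian,
      ← (summable_potential hs Δ'' ω).tsum_sub (summable_potential hs Δ'' ω')]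
    have := tsum_subtype {A : Finset I | (A ∩ Δ'').Nonempty}
      fun A => potential pos α A ω - potential pos α A ω'
    refine this.trans (tsum_congr fun A => ?_)
    by_cases hA : (A ∩ Δ'').Nonempty
    · exact indicator_of_mem (s := {A : Finset I | (A ∩ Δ'').Nonempty}) hA _
    · rw [indicator_of_notMem (s := {A : Finset I | (A ∩ Δ'').Nonempty}) hA,
        potential_congr pos α fun x hx => h x fun hxΔ => hA ⟨x, Finset.mem_inter.2 ⟨hx, hΔ'' hxΔ⟩⟩,
        sub_self]
  rw [key Δ' hΔ, key Δ le_rfl]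

/-- Among the pairs that contain `x`, only `{x, y}` sees the spin at `y`. -/
theorem hamiltonian_singleton_sub (hs : SummableCoupling pos α) {x y : I} (hxy : y ≠ x)
    {ω ω' : I → Circle}
    (h : ∀ z, z ≠ y → ω z = ω' z) :
    hamiltonian pos α {x} ω - hamiltonian pos α {x} ω' =
      coupling pos α x y * (inner ℝ (ω x : ℂ) (ω y : ℂ) - inner ℝ (ω' x : ℂ) (ω' y : ℂ)) := by
  rw [hamiltonian, hamiltonian,
    ← (summable_potential hs {x} ω).tsum_sub (summable_potential hs {x} ω'),
    tsum_eq_single ⟨{x, y}, ⟨x, by simp⟩⟩]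
  · rw [potential_pair pos α hxy.symm, potential_pair pos α hxy.symm, coupling]
    ring
  · rintro ⟨A, hA⟩ hne
    have hxA : x ∈ A := by
      obtain ⟨z, hz⟩ := hA
      rw [Finset.mem_inter, Finset.mem_singleton] at hz
      exact hz.2 ▸ hz.1
    by_cases hc : A.card = 2
    · obtain ⟨z, hz, rfl⟩ := exists_eq_pair hxA hc
      have hzy : z ≠ y := fun e => hne (by subst e; rfl)
      simp only
      rw [potential_congr pos α (ω := ω) (ω' := ω'), sub_self]
      intro v hv
      refine h v ?_
      simp only [Finset.mem_insert, Finset.mem_singleton] at hv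
      rcases hv with rfl | rfl
      · exact hxy.symm
      · exact hzy
    · simp [potential, hc]

end Hamiltonian

/-! ### Spins confined to arcs -/

section Boxes

variable {I : Type}

theorem integrable_of_continuous {X : Type*} [TopologicalSpace X] [CompactSpace X]
    [MeasurableSpace X] [OpensMeasurableSpace X] {m : Measure X} [IsFiniteMeasure m]
    {f : X → ℝ} (hf : Continuous f) : Integrable f m :=
  hf.integrable_of_hasCompactSupport (HasCompactSupport.of_compactSpace f)

/-- Lebesgue measure on the arc with label `k`. -/
noncomputable def arcMeasure {q : ℕ} [NeZero q] (k : Fin q) : Measure Circle :=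
  circleMeasure.restrict {z | discretise q z = k}

instance {q : ℕ} [NeZero q] (k : Fin q) : IsFiniteMeasure (arcMeasure k) := by
  unfold arcMeasure
  infer_instance

theorem arcMeasure_univ_pos {q : ℕ} [NeZero q] (k : Fin q) : 0 < arcMeasure k univ := by
  rw [arcMeasure, Measure.restrict_apply_univ]
  exact circleMeasure_discretise_pos q k

/-- Lebesgue measure on the spins in `Δ` that lie in the arcs prescribed by `ω'`. -/
noncomputable def boxMeasure {q : ℕ} [NeZero q] (ω' : I → Fin q) (Δ : Finset I) :
    Measure (Δ → Circle) :=
  Measure.pi fun x : Δ => arcMeasure (ω' x)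

instance {q : ℕ} [NeZero q] (ω' : I → Fin q) (Δ : Finset I) :
    IsFiniteMeasure (boxMeasure ω' Δ) := by
  unfold boxMeasure
  infer_instance

instance {q : ℕ} [NeZero q] (ω' : I → Fin q) (Δ : Finset I) : NeZero (boxMeasure ω' Δ) := by
  refine ⟨fun h => ?_⟩
  have h1 : boxMeasure ω' Δ univ = 0 := by rw [h]; rfl
  rw [boxMeasure, Measure.pi_univ, Finset.prod_eq_zero_iff] at h1
  obtain ⟨x, -, hx⟩ := h1
  exact (arcMeasure_univ_pos (ω' x)).ne' hx

theorem boxMeasure_eq_restrict {q : ℕ} [NeZero q] (ω' : I → Fin q) (Δ : Finset I) :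
    boxMeasure ω' Δ = (Measure.pi fun _ : Δ => circleMeasure).restrict
      {ζ | ∀ x, discretise q (ζ x) = ω' x} := by
  have := Measure.restrict_pi_pi (fun _ : Δ => circleMeasure)
    fun x : Δ => {z | discretise q z = ω' x}
  rw [boxMeasure]
  refine this.symm.trans ?_
  congr 1
  ext ζ
  simp

theorem boxMeasure_real_univ_pos {q : ℕ} [NeZero q] (ω' : I → Fin q) (Δ : Finset I) :
    0 < (boxMeasure ω' Δ).real univ :=
  ENNReal.toReal_pos (NeZero.ne _) (measure_ne_top _ _)

theorem boxMeasure_real_univ_le {q : ℕ} [NeZero q] (ω' : I → Fin q) (Δ : Finset I) :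
    (boxMeasure ω' Δ).real univ ≤ (Measure.pi fun _ : Δ => circleMeasure).real univ := by
  rw [boxMeasure_eq_restrict]
  exact ENNReal.toReal_mono (measure_ne_top _ _) (Measure.restrict_apply_le _ _)

theorem boxMeasure_singleton_congr {q : ℕ} [NeZero q] {ω₁ ω₂ : I → Fin q} {x : I}
    (h : ω₁ x = ω₂ x) : boxMeasure ω₁ {x} = boxMeasure ω₂ {x} := by
  unfold boxMeasure
  congr 1
  ext1 y
  have hy : y.1 = x := Finset.mem_singleton.1 y.2
  rw [hy, h]

theorem measurableSet_box {q : ℕ} [NeZero q] {J : Type*} [Countable J] (ω' : J → Fin q) :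
    MeasurableSet {ζ : J → Circle | ∀ x, discretise q (ζ x) = ω' x} := by
  have : {ζ : J → Circle | ∀ x, discretise q (ζ x) = ω' x} =
      ⋂ x, (fun ζ : J → Circle => ζ x) ⁻¹' {z | discretise q z = ω' x} := by
    ext ζ; simp
  rw [this]
  exact MeasurableSet.iInter fun x => measurable_pi_apply x (measurableSet_discretise q _)

theorem ae_boxMeasure {q : ℕ} [NeZero q] (ω' : I → Fin q) (Δ : Finset I) :
    ∀ᵐ ζ ∂boxMeasure ω' Δ, ∀ x : Δ, discretise q (ζ x) = ω' x := by
  rw [boxMeasure_eq_restrict]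
  exact ae_restrict_mem (measurableSet_box fun x : Δ => ω' x)

end Boxes

/-! ### Gluing -/

section Glue

variable {I : Type} [DecidableEq I]

theorem glue_apply_mem {Δ : Finset I} (ζ : Δ → Circle) (η : I → Circle) {x : I} (h : x ∈ Δ) :
    glue Δ ζ η x = ζ ⟨x, h⟩ := dif_pos h

theorem glue_apply_notMem {Δ : Finset I} (ζ : Δ → Circle) (η : I → Circle) {x : I}
    (h : x ∉ Δ) : glue Δ ζ η x = η x := dif_neg h

theorem glue_congr {Δ : Finset I} (ζ : Δ → Circle) {η ξ : I → Circle}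
    (h : ∀ x, x ∉ Δ → η x = ξ x) : glue Δ ζ η = glue Δ ζ ξ := by
  ext1 x
  by_cases hx : x ∈ Δ
  · rw [glue_apply_mem ζ η hx, glue_apply_mem ζ ξ hx]
  · rw [glue_apply_notMem ζ η hx, glue_apply_notMem ζ ξ hx, h x hx]

theorem continuous_glue (Δ : Finset I) :
    Continuous fun p : (Δ → Circle) × (I → Circle) => glue Δ p.1 p.2 := by
  refine continuous_pi fun x => ?_
  by_cases hx : x ∈ Δ
  · simp only [glue_apply_mem _ _ hx]; fun_prop
  · simp only [glue_apply_notMem _ _ hx]; fun_prop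

theorem measurable_glue (Δ : Finset I) :
    Measurable fun p : (Δ → Circle) × (I → Circle) => glue Δ p.1 p.2 := by
  refine measurable_pi_lambda _ fun x => ?_
  by_cases hx : x ∈ Δ
  · simp only [glue_apply_mem _ _ hx]; fun_prop
  · simp only [glue_apply_notMem _ _ hx]; fun_prop

theorem continuous_glue_left (Δ : Finset I) (η : I → Circle) :
    Continuous fun ζ : Δ → Circle => glue Δ ζ η :=
  (continuous_glue Δ).comp (by fun_prop : Continuous fun ζ : Δ → Circle => (ζ, η))

theorem continuous_glue_right (Δ : Finset I) (ζ : Δ → Circle) :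
    Continuous fun η : I → Circle => glue Δ ζ η :=
  (continuous_glue Δ).comp (by fun_prop : Continuous fun η : I → Circle => (ζ, η))

theorem measurable_glue_left (Δ : Finset I) (η : I → Circle) :
    Measurable fun ζ : Δ → Circle => glue Δ ζ η :=
  (measurable_glue Δ).comp (by fun_prop : Measurable fun ζ : Δ → Circle => (ζ, η))

end Glue

/-! ### Averages with respect to the constrained specification -/

section Averages

variable {d : ℕ} {I : Type} [DecidableEq I] (pos : I → Site d) (α β : ℝ) {q : ℕ} [NeZero q]
  (ω' : I → Fin q)

/-- The Boltzmann factor. -/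
noncomputable def boltzmannFactor (Δ : Finset I) (ω : I → Circle) : ℝ :=
  Real.exp (-β * hamiltonian pos α Δ ω)

/-- The partition function of the constrained specification. -/
noncomputable def partitionFn (Δ : Finset I) (η : I → Circle) : ℝ :=
  ∫ ζ, boltzmannFactor pos α β Δ (glue Δ ζ η) ∂boxMeasure ω' Δ

/-- The average of `f` under the constrained specification. -/
noncomputable def specAverage (Δ : Finset I) (f : (I → Circle) → ℝ) (η : I → Circle) : ℝ :=
  (∫ ζ, f (glue Δ ζ η) * boltzmannFactor pos α β Δ (glue Δ ζ η) ∂boxMeasure ω' Δ) /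
    partitionFn pos α β ω' Δ η

theorem boltzmannFactor_pos (Δ : Finset I) (ω : I → Circle) :
    0 < boltzmannFactor pos α β Δ ω := Real.exp_pos _

theorem specAverage_congr (Δ : Finset I) (f : (I → Circle) → ℝ) {η ξ : I → Circle}
    (h : ∀ x, x ∉ Δ → η x = ξ x) :
    specAverage pos α β ω' Δ f η = specAverage pos α β ω' Δ f ξ := by
  simp only [specAverage, partitionFn, fun ζ : Δ → Circle => glue_congr ζ h]

variable {pos α}

theorem continuous_boltzmannFactor (hs : SummableCoupling pos α) (Δ : Finset I) :
    Continuous (boltzmannFactor pos α β Δ) :=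
  Real.continuous_exp.comp (continuous_const.mul (continuous_hamiltonian hs Δ))

theorem boltzmannFactor_le (hs : SummableCoupling pos α) (Δ : Finset I) (ω : I → Circle) :
    boltzmannFactor pos α β Δ ω ≤ Real.exp (|β| * hamiltonianBound pos α Δ) := by
  refine Real.exp_le_exp.2 ((le_abs_self _).trans ?_)
  rw [abs_mul, abs_neg]
  gcongr
  exact abs_hamiltonian_le hs Δ ω

theorem le_boltzmannFactor (hs : SummableCoupling pos α) (Δ : Finset I) (ω : I → Circle) :
    Real.exp (-(|β| * hamiltonianBound pos α Δ)) ≤ boltzmannFactor pos α β Δ ω := by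
  refine Real.exp_le_exp.2 (neg_le_of_neg_le ((neg_le_abs _).trans ?_))
  rw [abs_mul, abs_neg]
  gcongr
  exact abs_hamiltonian_le hs Δ ω

variable [Countable I]

/-- Source of the Feller property: together with a positive partition function it shows that the
kernels preserve continuous functions. -/
theorem continuous_integral_glue {Δ : Finset I} (m : Measure (Δ → Circle)) [IsFiniteMeasure m]
    {F : (I → Circle) → ℝ} (hF : Continuous F) :
    Continuous fun η => ∫ ζ, F (glue Δ ζ η) ∂m := by
  obtain ⟨C, hC⟩ := isCompact_univ.exists_bound_of_continuousOn hF.continuousOn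
  refine continuous_of_dominated (bound := fun _ => C)
    (fun η => (hF.comp (continuous_glue_left Δ η)).aestronglyMeasurable)
    (fun η => Eventually.of_forall fun ζ => hC _ (mem_univ _)) (integrable_const C)
    (Eventually.of_forall fun ζ => hF.comp (continuous_glue_right Δ ζ))

theorem integrable_boltzmannFactor_glue (hs : SummableCoupling pos α) (Δ : Finset I)
    (η : I → Circle) :
    Integrable (fun ζ => boltzmannFactor pos α β Δ (glue Δ ζ η)) (boxMeasure ω' Δ) :=
  integrable_of_continuous ((continuous_boltzmannFactor β hs Δ).comp (continuous_glue_left Δ η))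

theorem partitionFn_pos (hs : SummableCoupling pos α) (Δ : Finset I) (η : I → Circle) :
    0 < partitionFn pos α β ω' Δ η :=
  integral_exp_pos (integrable_boltzmannFactor_glue β ω' hs Δ η)

theorem continuous_partitionFn (hs : SummableCoupling pos α) (Δ : Finset I) :
    Continuous (partitionFn pos α β ω' Δ) :=
  continuous_integral_glue _ (continuous_boltzmannFactor β hs Δ)

theorem continuous_specAverage (hs : SummableCoupling pos α) (Δ : Finset I)
    {f : (I → Circle) → ℝ} (hf : Continuous f) : Continuous (specAverage pos α β ω' Δ f) :=
  (continuous_integral_glue _ (hf.mul (continuous_boltzmannFactor β hs Δ))).div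
    (continuous_partitionFn β ω' hs Δ) fun η => (partitionFn_pos β ω' hs Δ η).ne'

/-- Conditioning makes the first normalisation irrelevant: the unconstrained partition function
cancels, being finite and nonzero. What remains is the Boltzmann weight on the arcs with its own
normalisation. -/
theorem constrainedSpec_eq (hs : SummableCoupling pos α) (Δ : Finset I) (η : I → Circle) :
    constrainedSpec pos α β q ω' Δ η = (ENNReal.ofReal (partitionFn pos α β ω' Δ η))⁻¹ •
      ((boxMeasure ω' Δ).withDensity fun ζ =>
        ENNReal.ofReal (boltzmannFactor pos α β Δ (glue Δ ζ η))).map fun ζ => glue Δ ζ η := by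
  have hS : MeasurableSet {ω : I → Circle | ∀ x ∈ Δ, discretise q (ω x) = ω' x} := by
    have : {ω : I → Circle | ∀ x ∈ Δ, discretise q (ω x) = ω' x} =
        ⋂ x ∈ Δ, (fun ω : I → Circle => ω x) ⁻¹' {z | discretise q z = ω' x} := by
      ext ζ; simp
    rw [this]
    exact MeasurableSet.biInter Δ.countable_toSet fun x _ =>
      measurable_pi_apply x (measurableSet_discretise q _)
  have hg := measurable_glue_left Δ η
  have hpre : (fun ζ : Δ → Circle => glue Δ ζ η) ⁻¹'
      {ω : I → Circle | ∀ x ∈ Δ, discretise q (ω x) = ω' x} =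
      {ζ : Δ → Circle | ∀ x : Δ, discretise q (ζ x) = ω' x} := by
    ext ζ
    constructor
    · intro h x
      exact (congrArg (discretise q) (glue_apply_mem ζ η x.2)).symm.trans (h x x.2)
    · intro h x hx
      refine (congrArg (discretise q) (glue_apply_mem ζ η hx)).trans ?_
      exact h ⟨x, hx⟩
  have hrest : (boltzmann pos α β Δ η).restrict
      {ω : I → Circle | ∀ x ∈ Δ, discretise q (ω x) = ω' x} =
      ((boxMeasure ω' Δ).withDensity fun ζ =>
        ENNReal.ofReal (boltzmannFactor pos α β Δ (glue Δ ζ η))).map fun ζ => glue Δ ζ η := by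
    rw [boltzmann, Measure.restrict_map hg hS, restrict_withDensity (hg hS), hpre,
      ← boxMeasure_eq_restrict]
    rfl
  have hmass : boltzmann pos α β Δ η {ω : I → Circle | ∀ x ∈ Δ, discretise q (ω x) = ω' x} =
      ENNReal.ofReal (partitionFn pos α β ω' Δ η) := by
    rw [← Measure.restrict_apply_univ, hrest, Measure.map_apply hg MeasurableSet.univ,
      preimage_univ, withDensity_apply _ MeasurableSet.univ, Measure.restrict_univ, partitionFn,
      ofReal_integral_eq_lintegral_ofReal (integrable_boltzmannFactor_glue β ω' hs Δ η)
        (Eventually.of_forall fun ζ => (boltzmannFactor_pos pos α β Δ _).le)]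
  have htop : boltzmann pos α β Δ η univ ≠ ⊤ := by
    rw [boltzmann, Measure.map_apply hg MeasurableSet.univ, preimage_univ,
      withDensity_apply _ MeasurableSet.univ, Measure.restrict_univ]
    have hi : Integrable (fun ζ => boltzmannFactor pos α β Δ (glue Δ ζ η))
        (Measure.pi fun _ : Δ => circleMeasure) :=
      integrable_of_continuous
        ((continuous_boltzmannFactor β hs Δ).comp (continuous_glue_left Δ η))
    exact hi.lintegral_lt_top.ne
  have hzero : boltzmann pos α β Δ η univ ≠ 0 := by
    refine (lt_of_lt_of_le ?_ (measure_mono (subset_univ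
      {ω : I → Circle | ∀ x ∈ Δ, discretise q (ω x) = ω' x}))).ne'
    rw [hmass, ENNReal.ofReal_pos]
    exact partitionFn_pos β ω' hs Δ η
  rw [constrainedSpec, ProbabilityTheory.cond, gibbsSpec, Measure.restrict_smul, hrest,
    Measure.smul_apply, hmass, smul_smul, smul_eq_mul,
    ENNReal.mul_inv (Or.inr ENNReal.ofReal_ne_top)
      (Or.inr (ENNReal.ofReal_pos.2 (partitionFn_pos β ω' hs Δ η)).ne'),
    inv_inv, mul_right_comm, ENNReal.mul_inv_cancel hzero htop, one_mul]

theorem integral_constrainedSpec (hs : SummableCoupling pos α) (Δ : Finset I) (η : I → Circle)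
    {f : (I → Circle) → ℝ} (hf : Continuous f) :
    ∫ ω, f ω ∂constrainedSpec pos α β q ω' Δ η = specAverage pos α β ω' Δ f η := by
  have hZ := partitionFn_pos β ω' hs Δ η
  have hw : Measurable fun ζ : Δ → Circle => boltzmannFactor pos α β Δ (glue Δ ζ η) :=
    ((continuous_boltzmannFactor β hs Δ).comp (continuous_glue_left Δ η)).measurable
  rw [constrainedSpec_eq β ω' hs, integral_smul_measure,
    integral_map (measurable_glue_left Δ η).aemeasurable hf.aestronglyMeasurable,
    integral_withDensity_eq_integral_toReal_smul hw.ennreal_ofReal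
      (Eventually.of_forall fun _ => ENNReal.ofReal_lt_top), specAverage,
    ENNReal.toReal_inv, ENNReal.toReal_ofReal hZ.le, smul_eq_mul, div_eq_inv_mul]
  congr 2
  ext ζ
  rw [ENNReal.toReal_ofReal (boltzmannFactor_pos pos α β Δ _).le, smul_eq_mul, mul_comm]

theorem isProbabilityMeasure_constrainedSpec (hs : SummableCoupling pos α) (Δ : Finset I)
    (η : I → Circle) : IsProbabilityMeasure (constrainedSpec pos α β q ω' Δ η) := by
  refine ⟨?_⟩
  have hZ := partitionFn_pos β ω' hs Δ η
  rw [constrainedSpec_eq β ω' hs, Measure.smul_apply,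
    Measure.map_apply (measurable_glue_left Δ η) MeasurableSet.univ, preimage_univ,
    withDensity_apply _ MeasurableSet.univ, Measure.restrict_univ,
    ← ofReal_integral_eq_lintegral_ofReal (integrable_boltzmannFactor_glue β ω' hs Δ η)
        (Eventually.of_forall fun ζ => (boltzmannFactor_pos pos α β Δ _).le), smul_eq_mul]
  exact ENNReal.inv_mul_cancel (ENNReal.ofReal_pos.2 hZ).ne' ENNReal.ofReal_ne_top

theorem measurable_constrainedSpec (hs : SummableCoupling pos α) (Δ : Finset I) :
    Measurable (constrainedSpec pos α β q ω' Δ) := by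
  refine Measure.measurable_of_measurable_coe _ fun B hB => ?_
  have hw : Measurable fun p : (I → Circle) × (Δ → Circle) =>
      ENNReal.ofReal (boltzmannFactor pos α β Δ (glue Δ p.2 p.1)) :=
    ((continuous_boltzmannFactor β hs Δ).measurable.comp
      ((measurable_glue Δ).comp measurable_swap)).ennreal_ofReal
  have h1 : ∀ η, constrainedSpec pos α β q ω' Δ η B =
      (ENNReal.ofReal (partitionFn pos α β ω' Δ η))⁻¹ * ∫⁻ ζ,
        ((fun p : (I → Circle) × (Δ → Circle) => glue Δ p.2 p.1) ⁻¹' B).indicator (fun p =>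
          ENNReal.ofReal (boltzmannFactor pos α β Δ (glue Δ p.2 p.1))) (η, ζ)
        ∂boxMeasure ω' Δ := by
    intro η
    have hg := measurable_glue_left Δ η
    rw [constrainedSpec_eq β ω' hs, Measure.smul_apply, Measure.map_apply hg hB,
      withDensity_apply _ (hg hB), ← lintegral_indicator (hg hB)]
    rfl
  simp only [h1]
  refine Measurable.mul ?_ ?_
  · exact (continuous_partitionFn β ω' hs Δ).measurable.ennreal_ofReal.inv
  · refine Measurable.lintegral_prod_right' (f := ((fun p : (I → Circle) × (Δ → Circle) =>
      glue Δ p.2 p.1) ⁻¹' B).indicator fun p =>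
          ENNReal.ofReal (boltzmannFactor pos α β Δ (glue Δ p.2 p.1))) ?_
    exact hw.indicator (((measurable_glue Δ).comp measurable_swap) hB)

end Averages

/-! ### Consistency of the constrained specification -/

section Consistency

variable {d : ℕ} {I : Type} [DecidableEq I] {pos : I → Site d} {α : ℝ} (β : ℝ) {q : ℕ} [NeZero q]
  (ω' : I → Fin q)

/-- Lebesgue measure on the spins in `Δ' \ Δ` that lie in the prescribed arcs. -/
noncomputable def annulusMeasure (Δ Δ' : Finset I) : Measure ({x : Δ' // x.1 ∉ Δ} → Circle) :=
  Measure.pi fun x : {x : Δ' // x.1 ∉ Δ} => arcMeasure (ω' x.1)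

instance (Δ Δ' : Finset I) : IsFiniteMeasure (annulusMeasure ω' Δ Δ') := by
  unfold annulusMeasure
  infer_instance

/-- Combine spins in `Δ` and spins in `Δ' \ Δ`. -/
def combine (Δ Δ' : Finset I) (p : (Δ → Circle) × ({x : Δ' // x.1 ∉ Δ} → Circle)) :
    Δ' → Circle :=
  fun x => if h : x.1 ∈ Δ then p.1 ⟨x, h⟩ else p.2 ⟨x, h⟩

/-- The configuration given by `ζ` in `Δ' \ Δ` and by `η` elsewhere. -/
def annulusGlue (Δ Δ' : Finset I) (ζ : {x : Δ' // x.1 ∉ Δ} → Circle) (η : I → Circle) :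
    I → Circle :=
  fun x => if h : x ∈ Δ' then if h' : x ∉ Δ then ζ ⟨⟨x, h⟩, h'⟩ else η x else η x

theorem glue_combine {Δ Δ' : Finset I} (hΔ : Δ ⊆ Δ') (ζ₁ : Δ → Circle)
    (ζ₂ : {x : Δ' // x.1 ∉ Δ} → Circle) (η : I → Circle) :
    glue Δ' (combine Δ Δ' (ζ₁, ζ₂)) η = glue Δ ζ₁ (annulusGlue Δ Δ' ζ₂ η) := by
  ext1 x
  by_cases hx : x ∈ Δ
  · rw [glue_apply_mem _ _ (hΔ hx), glue_apply_mem _ _ hx, combine, dif_pos hx]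
  · rw [glue_apply_notMem _ _ hx, annulusGlue]
    by_cases hx' : x ∈ Δ'
    · rw [glue_apply_mem _ _ hx', dif_pos hx', dif_pos hx, combine, dif_neg hx]
    · rw [glue_apply_notMem _ _ hx', dif_neg hx']

theorem measurable_combine (Δ Δ' : Finset I) : Measurable (combine Δ Δ') := by
  refine measurable_pi_lambda _ fun x => ?_
  by_cases hx : x.1 ∈ Δ
  · simp only [combine, dif_pos hx]; fun_prop
  · simp only [combine, dif_neg hx]; fun_prop

theorem continuous_combine (Δ Δ' : Finset I) : Continuous (combine Δ Δ') := by
  refine continuous_pi fun x => ?_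
  by_cases hx : x.1 ∈ Δ
  · simp only [combine, dif_pos hx]; fun_prop
  · simp only [combine, dif_neg hx]; fun_prop

/-- The constraint is a product over sites, so the reference measure on the larger box splits and
Fubini's theorem can isolate the inner volume. -/
theorem map_combine {Δ Δ' : Finset I} (hΔ : Δ ⊆ Δ') :
    ((boxMeasure ω' Δ).prod (annulusMeasure ω' Δ Δ')).map (combine Δ Δ') = boxMeasure ω' Δ' := by
  refine (Measure.pi_eq fun s hs => ?_).symm
  rw [Measure.map_apply (measurable_combine Δ Δ') (MeasurableSet.univ_pi hs)]
  have hpre : combine Δ Δ' ⁻¹' univ.pi s =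
      (univ.pi fun x : Δ => s ⟨x, hΔ x.2⟩) ×ˢ
        (univ.pi fun x : {x : Δ' // x.1 ∉ Δ} => s x.1) := by
    ext ⟨ζ₁, ζ₂⟩
    simp only [mem_preimage, mem_univ_pi, mem_prod]
    constructor
    · intro h
      refine ⟨fun x => ?_, fun x => ?_⟩
      · have := h ⟨x, hΔ x.2⟩
        rwa [combine, dif_pos x.2] at this
      · have := h x.1
        rwa [combine, dif_neg x.2] at this
    · rintro ⟨h1, h2⟩ x
      by_cases hx : x.1 ∈ Δ
      · rw [combine, dif_pos hx]; exact h1 ⟨x, hx⟩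
      · rw [combine, dif_neg hx]; exact h2 ⟨x, hx⟩
  rw [hpre, Measure.prod_prod, boxMeasure, annulusMeasure, Measure.pi_pi, Measure.pi_pi,
    ← Fintype.prod_subtype_mul_prod_subtype (fun x : Δ' => x.1 ∈ Δ)]
  congr 1
  let e : Δ ≃ {x : Δ' // x.1 ∈ Δ} :=
    { toFun := fun x => ⟨⟨x, hΔ x.2⟩, x.2⟩
      invFun := fun x => ⟨x.1.1, x.2⟩
      left_inv := fun _ => rfl
      right_inv := fun _ => rfl }
  exact Fintype.prod_equiv e _ _ fun _ => rfl

theorem integral_boxMeasure_eq {Δ Δ' : Finset I} (hΔ : Δ ⊆ Δ') {F : (I → Circle) → ℝ}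
    (hF : Continuous F) (η : I → Circle) :
    ∫ ζ, F (glue Δ' ζ η) ∂boxMeasure ω' Δ' =
      ∫ ζ₂, ∫ ζ₁, F (glue Δ ζ₁ (annulusGlue Δ Δ' ζ₂ η)) ∂boxMeasure ω' Δ
        ∂annulusMeasure ω' Δ Δ' := by
  have hc : Continuous fun ζ => F (glue Δ' ζ η) := hF.comp (continuous_glue_left Δ' η)
  rw [← map_combine ω' hΔ, integral_map (measurable_combine Δ Δ').aemeasurable
    hc.aestronglyMeasurable, integral_prod_symm]
  · simp only [glue_combine hΔ]
  · exact integrable_of_continuous (hc.comp (continuous_combine Δ Δ'))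

/-- `H_Δ' - H_Δ` does not depend on the spins in `Δ`. Hence the prefactor on the right does not
involve `ζ` and leaves the inner integral. -/
theorem boltzmannFactor_eq_mul (hs : SummableCoupling pos α) {Δ Δ' : Finset I} (hΔ : Δ ⊆ Δ')
    (ζ : Δ → Circle) (ξ : I → Circle) :
    boltzmannFactor pos α β Δ' (glue Δ ζ ξ) =
      boltzmannFactor pos α β Δ' ξ / boltzmannFactor pos α β Δ ξ *
        boltzmannFactor pos α β Δ (glue Δ ζ ξ) := by
  have := hamiltonian_sub_hamiltonian_eq hs hΔ (ω := glue Δ ζ ξ) (ω' := ξ)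
    fun x hx => glue_apply_notMem ζ ξ hx
  simp only [boltzmannFactor]
  rw [← Real.exp_sub, ← Real.exp_add]
  congr 1
  linear_combination (-β) * this

/-- Once the spins in `Δ' \ Δ` are fixed, the inner average is constant in the spins of `Δ`, and
integrating the remaining weight restores the partition function by which it divides. -/
theorem specAverage_specAverage [Countable I] (hs : SummableCoupling pos α) {Δ Δ' : Finset I}
    (hΔ : Δ ⊆ Δ') {f : (I → Circle) → ℝ} (hf : Continuous f) (η : I → Circle) :
    specAverage pos α β ω' Δ' (specAverage pos α β ω' Δ f) η = specAverage pos α β ω' Δ' f η := by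
  have hb := continuous_boltzmannFactor β hs Δ'
  have hfa := continuous_specAverage β ω' hs Δ hf
  rw [specAverage, specAverage,
    integral_boxMeasure_eq ω' hΔ
      (F := fun ω => specAverage pos α β ω' Δ f ω * boltzmannFactor pos α β Δ' ω) (hfa.mul hb),
    integral_boxMeasure_eq ω' hΔ (F := fun ω => f ω * boltzmannFactor pos α β Δ' ω)
      (hf.mul hb)]
  congr 2
  ext ζ₂
  set ξ := annulusGlue Δ Δ' ζ₂ η
  have h1 : ∀ ζ, specAverage pos α β ω' Δ f (glue Δ ζ ξ) = specAverage pos α β ω' Δ f ξ :=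
    fun ζ => specAverage_congr pos α β ω' Δ f fun x hx => glue_apply_notMem ζ ξ hx
  have hZ := partitionFn_pos β ω' hs Δ ξ
  simp only [h1, boltzmannFactor_eq_mul β hs hΔ]
  have e1 : ∀ ζ : Δ → Circle, f (glue Δ ζ ξ) * (boltzmannFactor pos α β Δ' ξ /
      boltzmannFactor pos α β Δ ξ * boltzmannFactor pos α β Δ (glue Δ ζ ξ)) =
      boltzmannFactor pos α β Δ' ξ / boltzmannFactor pos α β Δ ξ *
        (f (glue Δ ζ ξ) * boltzmannFactor pos α β Δ (glue Δ ζ ξ)) := fun ζ => by ring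
  simp only [e1, integral_const_mul]
  rw [mul_left_comm]
  congr 1
  rw [specAverage, ← partitionFn, div_mul_cancel₀ _ hZ.ne']

end Consistency

/-! ### Dobrushin's condition -/

section Dobrushin

theorem siteOsc_ne_top {I : Type*} {f : (I → Circle) → ℝ} (hf : Continuous f) (x : I) :
    siteOsc x f ≠ ⊤ := by
  obtain ⟨C, hC⟩ := isCompact_univ.exists_bound_of_continuousOn hf.continuousOn
  refine ne_top_of_le_ne_top (b := ENNReal.ofReal (C + C)) ENNReal.ofReal_ne_top
    (siteOsc_le fun η ξ _ => ENNReal.ofReal_le_ofReal ?_)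
  exact (abs_sub _ _).trans (add_le_add (hC η (mem_univ _)) (hC ξ (mem_univ _)))

variable {d : ℕ} {I : Type} [DecidableEq I] {pos : I → Site d} {α : ℝ} (β : ℝ)
  {q : ℕ} [NeZero q]

variable (pos α q) in
/-- The bound for the interdependence matrix of the constrained specification. -/
noncomputable def interdependence (x y : I) : ℝ≥0∞ :=
  ENNReal.ofReal (|β| * Real.pi / q * coupling pos α x y)

/-- In this cross ratio every interaction other than that of `x` with `y` cancels, leaving the
exponent `β J(x, y) (s - t) · (η_y - ξ_y)`. The first difference is a chord of one arc, the second
has length at most `2`. -/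
theorem boltzmannFactor_mul_le (hs : SummableCoupling pos α) {x y : I} (hxy : y ≠ x)
    {η ξ : I → Circle} (h : ∀ z, z ≠ y → η z = ξ z) {s t : ({x} : Finset I) → Circle}
    (hst : discretise q (s ⟨x, Finset.mem_singleton_self x⟩) =
      discretise q (t ⟨x, Finset.mem_singleton_self x⟩)) :
    boltzmannFactor pos α β {x} (glue {x} s ξ) * boltzmannFactor pos α β {x} (glue {x} t η) ≤
      Real.exp (4 * (|β| * Real.pi / q * coupling pos α x y)) *
        (boltzmannFactor pos α β {x} (glue {x} s η) *
          boltzmannFactor pos α β {x} (glue {x} t ξ)) := by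
  have hx : x ∈ ({x} : Finset I) := Finset.mem_singleton_self x
  have hy : y ∉ ({x} : Finset I) := by simpa using hxy
  have hdiff : ∀ r : ({x} : Finset I) → Circle,
      hamiltonian pos α {x} (glue {x} r η) - hamiltonian pos α {x} (glue {x} r ξ) =
        coupling pos α x y * (inner ℝ (r ⟨x, hx⟩ : ℂ) (η y : ℂ) -
          inner ℝ (r ⟨x, hx⟩ : ℂ) (ξ y : ℂ)) := by
    intro r
    rw [hamiltonian_singleton_sub hs hxy (ω := glue {x} r η) (ω' := glue {x} r ξ),
      glue_apply_mem _ _ hx, glue_apply_mem _ _ hx, glue_apply_notMem _ _ hy,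
      glue_apply_notMem _ _ hy]
    intro z hz
    by_cases hzx : z ∈ ({x} : Finset I)
    · rw [glue_apply_mem _ _ hzx, glue_apply_mem _ _ hzx]
    · rw [glue_apply_notMem _ _ hzx, glue_apply_notMem _ _ hzx, h z hz]
  have hin : |inner ℝ ((s ⟨x, hx⟩ : ℂ) - (t ⟨x, hx⟩ : ℂ)) ((η y : ℂ) - (ξ y : ℂ))| ≤
      2 * Real.pi / q * 2 :=
    (abs_real_inner_le_norm _ _).trans (mul_le_mul (norm_sub_le_of_discretise_eq q hst)
      (norm_coe_sub_coe_le_two _ _) (norm_nonneg _) (by positivity))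
  have hbd : |β * (coupling pos α x y *
      inner ℝ ((s ⟨x, hx⟩ : ℂ) - (t ⟨x, hx⟩ : ℂ)) ((η y : ℂ) - (ξ y : ℂ)))| ≤
      4 * (|β| * Real.pi / q * coupling pos α x y) := by
    rw [abs_mul, abs_mul, abs_of_nonneg (coupling_nonneg pos α x y)]
    calc _ ≤ |β| * (coupling pos α x y * (2 * Real.pi / q * 2)) := by
          have := coupling_nonneg pos α x y
          gcongr
      _ = _ := by ring
  simp only [boltzmannFactor]
  rw [← Real.exp_add, ← Real.exp_add, ← Real.exp_add]
  refine Real.exp_le_exp.2 ?_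
  have h1 := hdiff s
  have h2 := hdiff t
  rw [inner_sub_left, inner_sub_right, inner_sub_right] at hbd
  have h3 := (le_abs_self _).trans hbd
  linear_combination h3 + β * h1 - β * h2

theorem isDobrushin_specAverage [Countable I] (hs : SummableCoupling pos α) (ω' : I → Fin q)
    {c : ℝ≥0∞} (hc : ∀ x, ∑' y, interdependence pos α β q x y ≤ c) :
    IsDobrushin (fun x => specAverage pos α β ω' {x}) (interdependence pos α β q) c where
  continuous x f hf := continuous_specAverage β ω' hs {x} hf
  siteOsc_self x f _ := by
    refine le_antisymm (siteOsc_le fun η ξ h => ?_) bot_le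
    rw [specAverage_congr pos α β ω' {x} f fun y hy => h y (by simpa using hy)]
    simp
  siteOsc_of_ne x y f hf hyx := by
    refine siteOsc_le fun η ξ h => ?_
    have hx : x ∈ ({x} : Finset I) := Finset.mem_singleton_self x
    set Kx := (siteOsc x f).toReal with hKx
    set Ky := (siteOsc y f).toReal with hKy
    have hfx := siteOsc_ne_top hf x
    have hfy := siteOsc_ne_top hf y
    set u := fun ζ => boltzmannFactor pos α β {x} (glue {x} ζ η) with hu
    set v := fun ζ => boltzmannFactor pos α β {x} (glue {x} ζ ξ) with hv
    -- Intermediate quantity: test function with boundary `ξ`, weight with boundary `η`. Passing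
    -- from it to `ξ` changes only the weight and costs `C x y` times the oscillation at `x`;
    -- passing to `η` changes only the function and costs the oscillation at `y`.
    set g := fun ζ : ({x} : Finset I) → Circle => f (glue {x} ζ ξ) with hg
    have hgc : Continuous g := hf.comp (continuous_glue_left {x} ξ)
    have hui : Integrable u (boxMeasure ω' {x}) := integrable_boltzmannFactor_glue β ω' hs {x} η
    have hvi : Integrable v (boxMeasure ω' {x}) := integrable_boltzmannFactor_glue β ω' hs {x} ξ
    have hU := partitionFn_pos β ω' hs {x} η
    have hV := partitionFn_pos β ω' hs {x} ξ
    have hcu : Continuous u :=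
      (continuous_boltzmannFactor β hs {x}).comp (continuous_glue_left {x} η)
    have hgK : ∀ s t, |g s - g t| ≤ Kx := fun s t => by
      rw [hKx, ← ENNReal.ofReal_le_iff_le_toReal hfx]
      refine le_siteOsc f fun z hz => ?_
      have hz' : z ∉ ({x} : Finset I) := by simpa using hz
      rw [glue_apply_notMem _ _ hz', glue_apply_notMem _ _ hz']
    have hD : 0 ≤ |β| * Real.pi / q * coupling pos α x y := by
      have := coupling_nonneg pos α x y
      have := Real.pi_pos
      positivity
    have h1 := abs_integral_div_sub_le (m := boxMeasure ω' {x}) (g := g) (u := u) (v := v)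
      (D := 4 * (|β| * Real.pi / q * coupling pos α x y)) (by positivity) hgc.measurable hgK
      hui hvi (fun s => (boltzmannFactor_pos pos α β _ _).le)
      (fun s => (boltzmannFactor_pos pos α β _ _).le) hU hV (by
        filter_upwards [ae_boxMeasure ω' {x}] with s hs'
        filter_upwards [ae_boxMeasure ω' {x}] with t ht'
        exact boltzmannFactor_mul_le β hs hyx h ((hs' ⟨x, hx⟩).trans (ht' ⟨x, hx⟩).symm))
    have h2 : |(∫ ζ, g ζ * u ζ ∂boxMeasure ω' {x}) / (∫ ζ, u ζ ∂boxMeasure ω' {x}) -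
        specAverage pos α β ω' {x} f η| ≤ Ky := by
      have hfi : Integrable (fun ζ => f (glue {x} ζ η) * u ζ) (boxMeasure ω' {x}) :=
        integrable_of_continuous ((hf.comp (continuous_glue_left {x} η)).mul hcu)
      have hgi : Integrable (fun ζ => g ζ * u ζ) (boxMeasure ω' {x}) :=
        integrable_of_continuous (hgc.mul hcu)
      rw [specAverage, partitionFn, ← sub_div, ← integral_sub hgi hfi, abs_div,
        abs_of_pos (show 0 < ∫ ζ, u ζ ∂boxMeasure ω' {x} from hU),
        div_le_iff₀ (show 0 < ∫ ζ, u ζ ∂boxMeasure ω' {x} from hU),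
        ← integral_const_mul]
      refine (abs_integral_le_integral_abs).trans (integral_mono (hgi.sub hfi).abs
        (hui.const_mul Ky) fun ζ => ?_)
      have hpos : 0 < u ζ := boltzmannFactor_pos pos α β _ _
      simp only
      rw [← sub_mul, abs_mul, abs_of_pos hpos]
      refine mul_le_mul_of_nonneg_right ?_ hpos.le
      rw [hKy, ← ENNReal.ofReal_le_iff_le_toReal hfy]
      refine le_siteOsc f fun z hz => ?_
      by_cases hzx : z ∈ ({x} : Finset I)
      · rw [glue_apply_mem _ _ hzx, glue_apply_mem _ _ hzx]
      · rw [glue_apply_notMem _ _ hzx, glue_apply_notMem _ _ hzx, h z hz]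
    have h3 : |specAverage pos α β ω' {x} f η - specAverage pos α β ω' {x} f ξ| ≤
        Ky + |β| * Real.pi / q * coupling pos α x y * Kx := by
      have e : 4 * (|β| * Real.pi / q * coupling pos α x y) / 4 =
        |β| * Real.pi / q * coupling pos α x y := by ring
      rw [e] at h1
      rw [abs_sub_comm]
      refine (abs_sub_le _ ((∫ ζ, g ζ * u ζ ∂boxMeasure ω' {x}) /
        (∫ ζ, u ζ ∂boxMeasure ω' {x})) _).trans ?_
      rw [add_comm]
      exact add_le_add h2 h1
    refine (ENNReal.ofReal_le_ofReal h3).trans ?_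
    rw [ENNReal.ofReal_add ENNReal.toReal_nonneg (mul_nonneg hD ENNReal.toReal_nonneg),
      ENNReal.ofReal_mul hD, ENNReal.ofReal_toReal hfx, ENNReal.ofReal_toReal hfy]
    rfl
  tsum_le := hc

end Dobrushin

/-! ### Existence, uniqueness and comparison of Gibbs measures -/

section Gibbs

variable {d : ℕ} {I : Type} [DecidableEq I] [Countable I] {pos : I → Site d} {α : ℝ} {β : ℝ}
  {q : ℕ} [NeZero q] {ω' : I → Fin q}

theorem integral_bind_constrainedSpec (hs : SummableCoupling pos α) (Δ : Finset I)
    (μ : Measure (I → Circle)) [IsProbabilityMeasure μ] :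
    IsProbabilityMeasure (μ.bind (constrainedSpec pos α β q ω' Δ)) ∧
      ∀ f : (I → Circle) → ℝ, Continuous f →
        ∫ ω, f ω ∂μ.bind (constrainedSpec pos α β q ω' Δ) =
          ∫ η, specAverage pos α β ω' Δ f η ∂μ := by
  let κ : ProbabilityTheory.Kernel (I → Circle) (I → Circle) :=
    ⟨constrainedSpec pos α β q ω' Δ, measurable_constrainedSpec β ω' hs Δ⟩
  have hκ : ProbabilityTheory.IsMarkovKernel κ :=
    ⟨fun η => isProbabilityMeasure_constrainedSpec β ω' hs Δ η⟩
  have hcomp : μ.bind (constrainedSpec pos α β q ω' Δ) =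
      (κ.comp (ProbabilityTheory.Kernel.const Unit μ)) () := by
    rw [ProbabilityTheory.Kernel.comp_apply, ProbabilityTheory.Kernel.const_apply]
    rfl
  rw [hcomp]
  refine ⟨inferInstance, fun f hf => ?_⟩
  rw [ProbabilityTheory.Kernel.integral_comp (integrable_of_continuous hf),
    ProbabilityTheory.Kernel.const_apply]
  exact integral_congr_ae (Eventually.of_forall fun η =>
    integral_constrainedSpec β ω' hs Δ η hf)

theorem isGibbs_iff_bind (hs : SummableCoupling pos α) {μ : Measure (I → Circle)} :
    IsGibbs (constrainedSpec pos α β q ω') μ ↔ IsProbabilityMeasure μ ∧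
      ∀ Δ, μ.bind (constrainedSpec pos α β q ω' Δ) = μ := by
  refine and_congr_right fun _ => forall_congr' fun Δ => ?_
  have hm := (measurable_constrainedSpec β ω' hs Δ).aemeasurable (μ := μ)
  constructor
  · intro h
    ext B hB
    rw [Measure.bind_apply hB hm, h B hB]
  · intro h B hB
    rw [← Measure.bind_apply hB hm, h]

theorem ext_of_forall_continuous {J : Type*} [Countable J] {μ ν : Measure (J → Circle)}
    [IsProbabilityMeasure μ] [IsProbabilityMeasure ν]
    (h : ∀ f : (J → Circle) → ℝ, Continuous f → ∫ ω, f ω ∂μ = ∫ ω, f ω ∂ν) : μ = ν := by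
  let _ : MetricSpace (J → Circle) := TopologicalSpace.metrizableSpaceMetric _
  exact ext_of_forall_integral_eq_of_IsFiniteMeasure fun f => h f f.continuous

/-- The DLR equations in integrated form. -/
theorem isGibbs_iff (hs : SummableCoupling pos α) {μ : Measure (I → Circle)} :
    IsGibbs (constrainedSpec pos α β q ω') μ ↔ IsProbabilityMeasure μ ∧
      ∀ (Δ : Finset I) (f : (I → Circle) → ℝ), Continuous f →
        ∫ η, specAverage pos α β ω' Δ f η ∂μ = ∫ η, f η ∂μ := by
  rw [isGibbs_iff_bind hs]
  refine and_congr_right fun _ => forall_congr' fun Δ => ?_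
  obtain ⟨hp, hint⟩ := integral_bind_constrainedSpec (β := β) (ω' := ω') hs Δ μ
  constructor
  · intro h f hf
    rw [← hint f hf, h]
  · intro h
    exact ext_of_forall_continuous fun f hf => (hint f hf).trans (h f hf)

/-- The probability measures on a compact metrisable space form a compact space, so the
finite-volume measures have a limit along an ultrafilter finer than `atTop`. The DLR equations
survive since the kernels preserve continuity. -/
theorem exists_isGibbs (hs : SummableCoupling pos α) :
    ∃ μ, IsGibbs (constrainedSpec pos α β q ω') μ := by
  let _ : MetricSpace (I → Circle) := TopologicalSpace.metrizableSpaceMetric _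
  let η₀ : I → Circle := fun _ => 1
  let m : Finset I → ProbabilityMeasure (I → Circle) := fun Δ =>
    ⟨constrainedSpec pos α β q ω' Δ η₀, isProbabilityMeasure_constrainedSpec β ω' hs Δ η₀⟩
  let U : Ultrafilter (Finset I) := Ultrafilter.of atTop
  have hU : (U : Filter (Finset I)) ≤ atTop := Ultrafilter.of_le atTop
  obtain ⟨μ, -, hμ⟩ := isCompact_univ.ultrafilter_le_nhds (U.map m) (by simp)
  have hlim : ∀ f : (I → Circle) → ℝ, Continuous f →
      Tendsto (fun Δ => specAverage pos α β ω' Δ f η₀) U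
        (𝓝 (∫ ω, f ω ∂(μ : Measure (I → Circle)))) := by
    intro f hf
    have h1 := ProbabilityMeasure.tendsto_iff_forall_integral_tendsto.1
      (show Tendsto m U (𝓝 μ) from hμ) (BoundedContinuousFunction.mkOfCompact ⟨f, hf⟩)
    refine h1.congr fun Δ => ?_
    exact integral_constrainedSpec β ω' hs Δ η₀ hf
  refine ⟨μ, (isGibbs_iff hs).2 ⟨inferInstance, fun Δ f hf => ?_⟩⟩
  refine tendsto_nhds_unique (hlim _ (continuous_specAverage β ω' hs Δ hf))
    ((hlim f hf).congr' ?_)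
  filter_upwards [hU (eventually_ge_atTop Δ)] with Δ' hΔ'
  exact (specAverage_specAverage β ω' hs hΔ' hf η₀).symm

/-- Resampling the spin at `x` changes a function at most by its oscillation at `x`. -/
theorem ofReal_abs_specAverage_sub_le (hs : SummableCoupling pos α) (ω' : I → Fin q) (x : I)
    {f : (I → Circle) → ℝ} (hf : Continuous f) (η : I → Circle) :
    ENNReal.ofReal |specAverage pos α β ω' {x} f η - f η| ≤ siteOsc x f := by
  have hfx := siteOsc_ne_top hf x
  rw [ENNReal.ofReal_le_iff_le_toReal hfx]
  have hw := integrable_boltzmannFactor_glue β ω' hs {x} η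
  have hZ := partitionFn_pos β ω' hs {x} η
  have hfi : Integrable (fun ζ => f (glue {x} ζ η) *
      boltzmannFactor pos α β {x} (glue {x} ζ η)) (boxMeasure ω' {x}) :=
    integrable_of_continuous ((hf.mul (continuous_boltzmannFactor β hs {x})).comp
      (continuous_glue_left {x} η))
  rw [specAverage, div_sub' hZ.ne', abs_div, abs_of_pos hZ, div_le_iff₀ hZ, partitionFn,
    mul_comm _ (f η), ← integral_const_mul, ← integral_const_mul,
    ← integral_sub hfi (hw.const_mul _)]
  refine abs_integral_le_integral_abs.trans (integral_mono (hfi.sub (hw.const_mul _)).abs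
    (hw.const_mul _) fun ζ => ?_)
  have hpos := boltzmannFactor_pos pos α β {x} (glue {x} ζ η)
  simp only
  rw [← sub_mul, abs_mul, abs_of_pos hpos]
  refine mul_le_mul_of_nonneg_right ?_ hpos.le
  rw [← ENNReal.ofReal_le_iff_le_toReal hfx]
  exact le_siteOsc f fun z hz => glue_apply_notMem _ _ (by simpa using hz)

variable {c : ℝ≥0∞}

/-- Comparison of Gibbs measures for two constraints. -/
theorem ofReal_abs_integral_sub_le_of_isGibbs (hs : SummableCoupling pos α)
    (hC : ∀ x, ∑' y, interdependence pos α β q x y ≤ c) (hc : c < 1) {ω₁ ω₂ : I → Fin q}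
    {μ ν : Measure (I → Circle)} (hμ : IsGibbs (constrainedSpec pos α β q ω₁) μ)
    (hν : IsGibbs (constrainedSpec pos α β q ω₂) ν) {a b : I → ℝ≥0∞}
    (hb : ∀ x, ω₁ x ≠ ω₂ x → 2 ≤ b x)
    (ha : ∀ x, b x + ∑' y, interdependence pos α β q x y * a y ≤ a x)
    {f : (I → Circle) → ℝ} (hf : Continuous f) (hfin : ∑' x, siteOsc x f ≠ ⊤) :
    ENNReal.ofReal |∫ η, f η ∂μ - ∫ η, f η ∂ν| ≤ ∑' x, a x * siteOsc x f := by
  obtain ⟨_, hμ⟩ := (isGibbs_iff hs).1 hμ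
  obtain ⟨_, hν⟩ := (isGibbs_iff hs).1 hν
  refine (isDobrushin_specAverage β hs ω₁ hC).le_tsum hc
    (D := fun f => ENNReal.ofReal |∫ η, f η ∂μ - ∫ η, f η ∂ν|) (a := a) (b := b)
    (fun f hf => ofReal_abs_integral_sub_integral_le μ ν hf) (fun x f hf => ?_) ha hf hfin
  rw [← hμ {x} f hf]
  refine (ofReal_abs_sub_triangle _ (∫ η, specAverage pos α β ω₁ {x} f η ∂ν) _).trans
    (add_le_add le_rfl ?_)
  by_cases hx : ω₁ x = ω₂ x
  · have hbox := boxMeasure_singleton_congr hx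
    have : specAverage pos α β ω₁ {x} f = specAverage pos α β ω₂ {x} f := by
      ext η
      simp only [specAverage, partitionFn, hbox]
    rw [this, hν {x} f hf]
    simp
  · have hfx := siteOsc_ne_top hf x
    have hi : ∀ ω : I → Fin q, Integrable (specAverage pos α β ω {x} f) ν := fun ω =>
      integrable_of_continuous (continuous_specAverage β ω hs {x} hf)
    have key : ∀ η, |specAverage pos α β ω₁ {x} f η - specAverage pos α β ω₂ {x} f η| ≤
        2 * (siteOsc x f).toReal := fun η => by
      have h1 := (ENNReal.ofReal_le_iff_le_toReal hfx).1
        (ofReal_abs_specAverage_sub_le (β := β) hs ω₁ x hf η)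
      have h2 := (ENNReal.ofReal_le_iff_le_toReal hfx).1
        (ofReal_abs_specAverage_sub_le (β := β) hs ω₂ x hf η)
      rw [abs_sub_comm] at h2
      linarith [abs_sub_le (specAverage pos α β ω₁ {x} f η) (f η)
        (specAverage pos α β ω₂ {x} f η)]
    have hle : |∫ η, specAverage pos α β ω₁ {x} f η ∂ν - ∫ η, f η ∂ν| ≤
        2 * (siteOsc x f).toReal := by
      rw [← hν {x} f hf, ← integral_sub (hi ω₁) (hi ω₂)]
      refine abs_integral_le_integral_abs.trans ((integral_mono ((hi ω₁).sub (hi ω₂)).abs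
        (integrable_const _) key).trans ?_)
      simp
    refine (ENNReal.ofReal_le_ofReal hle).trans ?_
    rw [ENNReal.ofReal_mul zero_le_two, ENNReal.ofReal_toReal hfx]
    gcongr
    simpa using hb x hx

theorem tendsto_integral_local (μ : Measure (I → Circle)) [IsProbabilityMeasure μ]
    {f : (I → Circle) → ℝ} (hf : Continuous f) :
    Tendsto (fun F : Finset I => ∫ η, f (fun x => if x ∈ F then η x else 1) ∂μ) atTop
      (𝓝 (∫ η, f η ∂μ)) := by
  obtain ⟨C, hC⟩ := isCompact_univ.exists_bound_of_continuousOn hf.continuousOn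
  refine tendsto_integral_filter_of_dominated_convergence (fun _ => C)
    (Eventually.of_forall fun F => ?_)
    (Eventually.of_forall fun F => Eventually.of_forall fun η => hC _ (mem_univ _))
    (integrable_const C) (Eventually.of_forall fun η => ?_)
  · refine (hf.comp (continuous_pi fun x => ?_)).aestronglyMeasurable
    split_ifs <;> fun_prop
  · refine (hf.tendsto η).comp (tendsto_pi_nhds.2 fun y => tendsto_const_nhds.congr' ?_)
    filter_upwards [eventually_ge_atTop {y}] with F hF
    rw [if_pos (hF (Finset.mem_singleton_self y))]

theorem existsUnique_isGibbs (hs : SummableCoupling pos α)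
    (hC : ∀ x, ∑' y, interdependence pos α β q x y ≤ c) (hc : c < 1) (ω' : I → Fin q) :
    ∃! μ, IsGibbs (constrainedSpec pos α β q ω') μ := by
  obtain ⟨μ, hμ⟩ := exists_isGibbs (β := β) (q := q) (ω' := ω') hs
  refine ⟨μ, hμ, fun ν hν => ?_⟩
  have := hμ.1
  have := hν.1
  refine ext_of_forall_continuous fun f hf => ?_
  refine tendsto_nhds_unique (tendsto_integral_local ν hf)
    ((tendsto_integral_local μ hf).congr fun F => ?_)
  set g : (I → Circle) → ℝ := fun η => f fun x => if x ∈ F then η x else 1 with hg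
  have hgc : Continuous g := hf.comp (continuous_pi fun x => by split_ifs <;> fun_prop)
  have hoff : ∀ x, x ∉ F → siteOsc x g = 0 := fun x hx => by
    refine le_antisymm (siteOsc_le fun η ξ h => ?_) bot_le
    have : g η = g ξ := by
      simp only [hg]
      congr 1
      ext1 y
      split_ifs with hy
      · exact h y fun e => hx (e ▸ hy)
      · rfl
    simp [this]
  have hfin : ∑' x, siteOsc x g ≠ ⊤ := by
    rw [tsum_eq_sum hoff]
    exact ENNReal.sum_ne_top.2 fun x _ => siteOsc_ne_top hgc x
  have := ofReal_abs_integral_sub_le_of_isGibbs hs hC hc hμ hν (a := 0) (b := 0)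
    (fun x hx => absurd rfl hx) (fun x => by simp) hgc hfin
  simp only [Pi.zero_apply, zero_mul, tsum_zero, nonpos_iff_eq_zero, ENNReal.ofReal_eq_zero] at this
  exact sub_eq_zero.1 (abs_nonpos_iff.1 this)

end Gibbs

/-! ### Relabelling the sites -/

section Relabel

variable {d : ℕ} {I J : Type} {posI : I → Site d} {posJ : J → Site d} (e : I ≃ J)

theorem potential_map (α : ℝ) (h : ∀ x y, posJ (e x) - posJ (e y) = posI x - posI y)
    (A : Finset I) (ω : J → Circle) :
    potential posJ α (A.map e.toEmbedding) ω = potential posI α A fun x => ω (e x) := by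
  unfold potential
  rw [Finset.card_map]
  split_ifs
  · congr 1
    refine (Finset.sum_nbij' (fun p => (e p.1, e p.2)) (fun p => (e.symm p.1, e.symm p.2))
      ?_ ?_ ?_ ?_ ?_).symm <;> simp [Finset.mem_offDiag, h]
  · rfl

/-- The bijection between `Δ` and its image. -/
def mapEquiv (Δ : Finset I) : Δ ≃ Δ.map e.toEmbedding where
  toFun x := ⟨e x, Finset.mem_map_of_mem e.toEmbedding x.2⟩
  invFun y := ⟨e.symm y, by
    obtain ⟨x, hx, hxy⟩ := Finset.mem_map.1 y.2
    rw [← hxy]; simpa using hx⟩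
  left_inv x := by simp
  right_inv y := by simp

theorem integral_pi_map (Δ : Finset I) (m : I → Measure Circle) [∀ x, SigmaFinite (m x)]
    (g : (Δ → Circle) → ℝ) :
    ∫ ζ, g (fun x => ζ (mapEquiv e Δ x))
        ∂Measure.pi (fun y : Δ.map e.toEmbedding => m (e.symm y)) =
      ∫ ζ, g ζ ∂Measure.pi (fun x : Δ => m x) := by
  have hmp := measurePreserving_piCongrLeft (fun x : Δ => m x) (mapEquiv e Δ).symm
  rw [← hmp.integral_comp' g]
  refine integral_congr_ae (Eventually.of_forall fun ζ => ?_)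
  refine congrArg g (funext fun x => ?_)
  obtain ⟨y, rfl⟩ := (mapEquiv e Δ).symm.surjective x
  rw [Equiv.apply_symm_apply]
  exact (Equiv.piCongrLeft_apply_apply (fun _ => Circle) (mapEquiv e Δ).symm ζ y).symm

theorem integral_boxMeasure_map {q : ℕ} [NeZero q] (Δ : Finset I) (ω' : I → Fin q)
    (g : (Δ → Circle) → ℝ) :
    ∫ ζ, g (fun x => ζ (mapEquiv e Δ x))
        ∂boxMeasure (fun y => ω' (e.symm y)) (Δ.map e.toEmbedding) =
      ∫ ζ, g ζ ∂boxMeasure ω' Δ :=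
  integral_pi_map e Δ (fun x => arcMeasure (ω' x)) g

variable [DecidableEq I] [DecidableEq J]

theorem hamiltonian_map (α : ℝ) (h : ∀ x y, posJ (e x) - posJ (e y) = posI x - posI y)
    (Δ : Finset I) (ω : J → Circle) :
    hamiltonian posJ α (Δ.map e.toEmbedding) ω = hamiltonian posI α Δ fun x => ω (e x) := by
  have hiff : ∀ A : Finset I, (A ∩ Δ).Nonempty ↔
      (e.finsetCongr A ∩ Δ.map e.toEmbedding).Nonempty := fun A => by
    rw [Equiv.finsetCongr_apply, ← Finset.map_inter, Finset.map_nonempty]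
  rw [hamiltonian, hamiltonian, ← (e.finsetCongr.subtypeEquiv hiff).tsum_eq]
  refine tsum_congr fun A => ?_
  exact potential_map e α h A.1 ω

theorem glue_map (Δ : Finset I) (ζ : Δ.map e.toEmbedding → Circle) (η : J → Circle) :
    (fun x => glue (Δ.map e.toEmbedding) ζ η (e x)) =
      glue Δ (fun x => ζ (mapEquiv e Δ x)) fun x => η (e x) := by
  ext1 x
  by_cases hx : x ∈ Δ
  · rw [glue_apply_mem _ _ hx]
    exact glue_apply_mem ζ η (Finset.mem_map_of_mem e.toEmbedding hx)
  · rw [glue_apply_notMem _ _ hx, glue_apply_notMem]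
    simpa using hx

theorem specAverage_map (α β : ℝ) (h : ∀ x y, posJ (e x) - posJ (e y) = posI x - posI y)
    {q : ℕ} [NeZero q] (ω' : I → Fin q) (Δ : Finset I) (f : (J → Circle) → ℝ)
    (η : J → Circle) :
    specAverage posJ α β (fun y => ω' (e.symm y)) (Δ.map e.toEmbedding) f η =
      specAverage posI α β ω' Δ (fun ω => f fun y => ω (e.symm y)) fun x => η (e x) := by
  have hb : ∀ ζ, boltzmannFactor posJ α β (Δ.map e.toEmbedding)
      (glue (Δ.map e.toEmbedding) ζ η) = boltzmannFactor posI α β Δ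
        (glue Δ (fun x => ζ (mapEquiv e Δ x)) fun x => η (e x)) := fun ζ => by
    rw [boltzmannFactor, hamiltonian_map e α h, glue_map, boltzmannFactor]
  have hf : ∀ ζ, f (glue (Δ.map e.toEmbedding) ζ η) =
      f fun y => glue Δ (fun x => ζ (mapEquiv e Δ x)) (fun x => η (e x)) (e.symm y) := fun ζ => by
    rw [← glue_map]
    simp
  rw [specAverage, specAverage, partitionFn, partitionFn]
  simp only [hb, hf]
  congr 1
  · exact integral_boxMeasure_map e Δ ω' fun ζ =>
      f (fun y => glue Δ ζ (fun x => η (e x)) (e.symm y)) *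
        boltzmannFactor posI α β Δ (glue Δ ζ fun x => η (e x))
  · exact integral_boxMeasure_map e Δ ω' fun ζ =>
      boltzmannFactor posI α β Δ (glue Δ ζ fun x => η (e x))

theorem IsGibbs.map [Countable I] [Countable J] {α β : ℝ} (hsI : SummableCoupling posI α)
    (hsJ : SummableCoupling posJ α) (h : ∀ x y, posJ (e x) - posJ (e y) = posI x - posI y)
    {q : ℕ} [NeZero q] {ω' : I → Fin q} {μ : Measure (I → Circle)}
    (hμ : IsGibbs (constrainedSpec posI α β q ω') μ) :
    IsGibbs (constrainedSpec posJ α β q fun y => ω' (e.symm y))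
      (μ.map fun ω y => ω (e.symm y)) := by
  have hm : Measurable fun (ω : I → Circle) (y : J) => ω (e.symm y) := by fun_prop
  obtain ⟨hp, hμ⟩ := (isGibbs_iff hsI).1 hμ
  refine (isGibbs_iff hsJ).2 ⟨Measure.isProbabilityMeasure_map hm.aemeasurable, fun Δ f hf => ?_⟩
  obtain ⟨Δ, rfl⟩ : ∃ Δ' : Finset I, Δ'.map e.toEmbedding = Δ :=
    ⟨Δ.map e.symm.toEmbedding, by simp [Finset.map_map]⟩
  rw [integral_map hm.aemeasurable
    (continuous_specAverage β _ hsJ _ hf).aestronglyMeasurable,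
    integral_map hm.aemeasurable hf.aestronglyMeasurable]
  simp only [specAverage_map e α β h, Equiv.symm_apply_apply]
  exact hμ Δ _ (hf.comp (by fun_prop))

end Relabel

/-! ### Summability of the couplings on the lattice -/

section Lattice

variable {d : ℕ}

theorem norm_le_siteNorm (x : Site d) : ‖x‖ ≤ siteNorm x := by
  refine (pi_norm_le_iff_of_nonneg (siteNorm_nonneg x)).2 fun i => ?_
  rw [Int.norm_eq_abs, ← Real.sqrt_sq_eq_abs]
  exact Real.sqrt_le_sqrt (Finset.single_le_sum (f := fun i => (x i : ℝ) ^ 2)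
    (fun j _ => sq_nonneg _) (Finset.mem_univ i))

theorem siteNorm_zero_rpow {α : ℝ} (hα : 0 < α) : siteNorm (0 : Site d) ^ (-α) = 0 := by
  simp [siteNorm, Real.zero_rpow (neg_ne_zero.2 hα.ne')]

theorem siteNorm_rpow_le {α : ℝ} (hα : 0 < α) (x : Site d) :
    siteNorm x ^ (-α) ≤ ‖x‖ ^ (-α) := by
  rcases eq_or_ne x 0 with rfl | hx
  · rw [siteNorm_zero_rpow hα]
    exact Real.rpow_nonneg (norm_nonneg _) _
  · exact Real.rpow_le_rpow_of_nonpos (norm_pos_iff.2 hx) (norm_le_siteNorm x) (by linarith)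

theorem summable_siteNorm_rpow (hd : d = 1 ∨ d = 2) {α : ℝ} (hα : (d : ℝ) < α) :
    Summable fun x : Site d => siteNorm x ^ (-α) := by
  have hα0 : 0 < α := lt_of_le_of_lt (Nat.cast_nonneg d) hα
  refine Summable.of_nonneg_of_le (fun x => Real.rpow_nonneg (siteNorm_nonneg x) _)
    (siteNorm_rpow_le hα0) ?_
  rcases hd with rfl | rfl
  · rw [← (Equiv.funUnique (Fin 1) ℤ).symm.summable_iff]
    refine (Real.summable_abs_int_rpow (b := α) (by simpa using hα)).congr fun n => ?_
    have : ‖(Equiv.funUnique (Fin 1) ℤ).symm n‖ = |(n : ℝ)| := by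
      rw [← Int.norm_eq_abs]
      exact pi_norm_const n
    simp only [Function.comp_apply, this]
  · exact EisensteinSeries.summable_one_div_norm_rpow (by simpa using hα)

variable {I : Type} {pos : I → Site d}

theorem summableCoupling_of_injective {α : ℝ}
    (hsum : Summable fun x : Site d => siteNorm x ^ (-α)) (hpos : Function.Injective pos) :
    SummableCoupling pos α := fun x =>
  hsum.comp_injective (i := fun y => pos x - pos y) (sub_right_injective.comp hpos)

theorem tsum_interdependence_le {α : ℝ} (hα : 0 < α) (β : ℝ) (q : ℕ)
    (hsum : Summable fun x : Site d => siteNorm x ^ (-α)) (hpos : Function.Injective pos) (x : I) :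
    ∑' y, interdependence pos α β q x y ≤
      ENNReal.ofReal (|β| * Real.pi / q * ∑' x : {x : Site d // x ≠ 0}, siteNorm x.1 ^ (-α)) := by
  have hk : 0 ≤ |β| * Real.pi / q := by
    have := Real.pi_pos
    positivity
  have h1 : ∑' x : {x : Site d // x ≠ 0}, siteNorm x.1 ^ (-α) =
      ∑' x : Site d, siteNorm x ^ (-α) :=
    tsum_subtype_eq_of_support_subset (s := {x : Site d | x ≠ 0})
      (f := fun x : Site d => siteNorm x ^ (-α))
      fun x hx h0 => hx (by rw [h0]; exact siteNorm_zero_rpow hα)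
  rw [h1, ← tsum_mul_left, ENNReal.ofReal_tsum_of_nonneg
    (fun z => mul_nonneg hk (Real.rpow_nonneg (siteNorm_nonneg z) _)) (hsum.mul_left _)]
  exact ENNReal.tsum_comp_le_tsum_of_injective (f := fun y => pos x - pos y)
    (sub_right_injective.comp hpos)
    fun z => ENNReal.ofReal (|β| * Real.pi / q * siteNorm z ^ (-α))

end Lattice

/-! ### Properties of the discrete specification -/

section DiscreteSpec

variable {d : ℕ} {α β : ℝ} {q : ℕ} [NeZero q]

theorem isGibbs_constrainedGibbs {Λ : Finset (Site d)} {ω' : {x : Site d // x ∉ Λ} → Fin q}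
    (h : ∃! μ, IsGibbs (restrictedSpec α β q Λ ω') μ) :
    IsGibbs (restrictedSpec α β q Λ ω') (constrainedGibbs α β q Λ ω') := by
  rw [constrainedGibbs, dif_pos h]
  exact h.choose_spec.1

/-- The average over the spins in `Λ` of the Boltzmann factor, as a function of the spins outside
`Λ`. -/
noncomputable def joinAverage (α β : ℝ) (Λ : Finset (Site d)) (m : Measure (Λ → Circle))
    (ω : {x : Site d // x ∉ Λ} → Circle) : ℝ :=
  ∫ ζ, boltzmannFactor id α β Λ (join Λ ζ ω) ∂m

theorem discreteSpec_eq (Λ : Finset (Site d)) (η : Site d → Fin q) :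
    discreteSpec α β q Λ η =
      (∫ ω, joinAverage α β Λ (boxMeasure η Λ) ω ∂constrainedGibbs α β q Λ fun x => η x) /
      ∫ ω, joinAverage α β Λ (Measure.pi fun _ : Λ => circleMeasure) ω
        ∂constrainedGibbs α β q Λ fun x => η x := by
  rw [boxMeasure_eq_restrict]
  rfl

/-! #### Bounds for the Boltzmann averages -/

theorem continuous_join (Λ : Finset (Site d)) :
    Continuous fun p : (Λ → Circle) × ({x : Site d // x ∉ Λ} → Circle) => join Λ p.1 p.2 := by
  refine continuous_pi fun x => ?_
  by_cases hx : x ∈ Λ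
  · simp only [join, dif_pos hx]; fun_prop
  · simp only [join, dif_neg hx]; fun_prop

theorem continuous_boltzmannFactor_join (hs : SummableCoupling (id : Site d → Site d) α)
    (Λ : Finset (Site d)) (ω : {x : Site d // x ∉ Λ} → Circle) :
    Continuous fun ζ : Λ → Circle => boltzmannFactor id α β Λ (join Λ ζ ω) :=
  (continuous_boltzmannFactor β hs Λ).comp
    ((continuous_join Λ).comp (by fun_prop : Continuous fun ζ : Λ → Circle => (ζ, ω)))

theorem continuous_joinAverage (hs : SummableCoupling (id : Site d → Site d) α)
    (Λ : Finset (Site d)) (m : Measure (Λ → Circle)) [IsFiniteMeasure m] :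
    Continuous (joinAverage α β Λ m) := by
  refine continuous_of_dominated
    (bound := fun _ => Real.exp (|β| * hamiltonianBound (id : Site d → Site d) α Λ))
    (fun ω => (continuous_boltzmannFactor_join hs Λ ω).aestronglyMeasurable)
    (fun ω => Eventually.of_forall fun ζ => ?_) (integrable_const _)
    (Eventually.of_forall fun ζ => (continuous_boltzmannFactor β hs Λ).comp
      ((continuous_join Λ).comp (by fun_prop :
        Continuous fun ω : {x : Site d // x ∉ Λ} → Circle => (ζ, ω))))
  rw [Real.norm_eq_abs, abs_of_pos (boltzmannFactor_pos id α β Λ _)]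
  exact boltzmannFactor_le β hs Λ _

theorem joinAverage_le (hs : SummableCoupling (id : Site d → Site d) α)
    (Λ : Finset (Site d)) (m : Measure (Λ → Circle)) [IsFiniteMeasure m]
    (ω : {x : Site d // x ∉ Λ} → Circle) :
    joinAverage α β Λ m ω ≤
      m.real univ * Real.exp (|β| * hamiltonianBound (id : Site d → Site d) α Λ) := by
  refine (integral_mono (integrable_of_continuous (continuous_boltzmannFactor_join hs Λ ω))
    (integrable_const _) fun ζ => boltzmannFactor_le β hs Λ _).trans ?_
  simp

theorem le_joinAverage (hs : SummableCoupling (id : Site d → Site d) α)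
    (Λ : Finset (Site d)) (m : Measure (Λ → Circle)) [IsFiniteMeasure m]
    (ω : {x : Site d // x ∉ Λ} → Circle) :
    m.real univ * Real.exp (-(|β| * hamiltonianBound (id : Site d → Site d) α Λ)) ≤
      joinAverage α β Λ m ω := by
  refine le_trans ?_ (integral_mono (integrable_const _)
    (integrable_of_continuous (continuous_boltzmannFactor_join hs Λ ω))
    fun ζ => le_boltzmannFactor β hs Λ _)
  simp

theorem joinAverage_boxMeasure_le (hs : SummableCoupling (id : Site d → Site d) α)
    (Λ : Finset (Site d)) (η : Site d → Fin q) (ω : {x : Site d // x ∉ Λ} → Circle) :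
    joinAverage α β Λ (boxMeasure η Λ) ω ≤
      joinAverage α β Λ (Measure.pi fun _ : Λ => circleMeasure) ω := by
  rw [joinAverage, boxMeasure_eq_restrict]
  exact setIntegral_le_integral
    (integrable_of_continuous (continuous_boltzmannFactor_join hs Λ ω))
    (Eventually.of_forall fun ζ => (boltzmannFactor_pos id α β Λ _).le)

theorem abs_exp_sub_exp_le {a b L : ℝ} (ha : a ≤ L) (hb : b ≤ L) :
    |Real.exp a - Real.exp b| ≤ Real.exp L * |a - b| := by
  wlog h : b ≤ a generalizing a b
  · rw [abs_sub_comm, abs_sub_comm a]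
    exact this hb ha (le_of_not_ge h)
  rw [abs_of_nonneg (sub_nonneg.2 (Real.exp_le_exp.2 h)), abs_of_nonneg (sub_nonneg.2 h)]
  have h1 : Real.exp b = Real.exp a * Real.exp (b - a) := by rw [← Real.exp_add]; congr 1; ring
  have h2 : 1 - Real.exp (b - a) ≤ a - b := by linarith [Real.add_one_le_exp (b - a)]
  calc Real.exp a - Real.exp b = Real.exp a * (1 - Real.exp (b - a)) := by rw [h1]; ring
    _ ≤ Real.exp a * (a - b) := by gcongr
    _ ≤ Real.exp L * (a - b) := by
      have := sub_nonneg.2 h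
      gcongr

theorem siteOsc_joinAverage_le (hs : SummableCoupling (id : Site d → Site d) α)
    (m : Measure (({0} : Finset (Site d)) → Circle)) [IsFiniteMeasure m]
    (y : {x : Site d // x ∉ ({0} : Finset (Site d))}) :
    siteOsc y (joinAverage α β {0} m) ≤ ENNReal.ofReal
      (m.real univ * (Real.exp (|β| * hamiltonianBound (id : Site d → Site d) α {0}) *
        (|β| * 2)) * coupling id α 0 y.1) := by
  refine siteOsc_le fun ω ω' h => ENNReal.ofReal_le_ofReal ?_
  have hy : y.1 ≠ 0 := fun h0 => y.2 (by simp [h0])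
  set L := |β| * hamiltonianBound (id : Site d → Site d) α {0} with hL
  have hJ := coupling_nonneg (id : Site d → Site d) α 0 y.1
  have hpt : ∀ ζ, |boltzmannFactor id α β {0} (join {0} ζ ω) -
      boltzmannFactor id α β {0} (join {0} ζ ω')| ≤
      Real.exp L * (|β| * 2) * coupling id α 0 y.1 := by
    intro ζ
    have hle : ∀ ω, -β * hamiltonian id α {0} (join {0} ζ ω) ≤ L := fun ω => by
      refine (le_abs_self _).trans ?_
      rw [abs_mul, abs_neg]
      exact mul_le_mul_of_nonneg_left (abs_hamiltonian_le hs {0} _) (abs_nonneg β)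
    refine (abs_exp_sub_exp_le (hle ω) (hle ω')).trans ?_
    have hH := hamiltonian_singleton_sub hs hy (ω := join {0} ζ ω) (ω' := join {0} ζ ω')
      fun z hz => by
        by_cases hz0 : z ∈ ({0} : Finset (Site d))
        · rw [join, join, dif_pos hz0, dif_pos hz0]
        · rw [join, join, dif_neg hz0, dif_neg hz0]
          exact h ⟨z, hz0⟩ fun e => hz (congrArg Subtype.val e)
    rw [← mul_sub, hH, abs_mul, abs_neg, abs_mul, abs_of_nonneg hJ]
    have h2 : |inner ℝ (join {0} ζ ω 0 : ℂ) (join {0} ζ ω y.1 : ℂ) -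
        inner ℝ (join {0} ζ ω' 0 : ℂ) (join {0} ζ ω' y.1 : ℂ)| ≤ 2 :=
      (abs_sub _ _).trans (by
        linarith [abs_inner_coe_le_one (join {0} ζ ω 0) (join {0} ζ ω y.1),
          abs_inner_coe_le_one (join {0} ζ ω' 0) (join {0} ζ ω' y.1)])
    calc _ ≤ Real.exp L * (|β| * (coupling id α 0 y.1 * 2)) := by gcongr
      _ = _ := by ring
  have hi : ∀ ω, Integrable (fun ζ => boltzmannFactor id α β {0} (join {0} ζ ω)) m := fun ω =>
    integrable_of_continuous (continuous_boltzmannFactor_join hs {0} ω)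
  rw [joinAverage, joinAverage, ← integral_sub (hi ω) (hi ω')]
  refine abs_integral_le_integral_abs.trans ((integral_mono ((hi ω).sub (hi ω')).abs
    (integrable_const _) hpt).trans ?_)
  rw [integral_const, smul_eq_mul]
  exact le_of_eq (by ring)

/-! #### Translation invariance -/

theorem join_map (e : Site d ≃ Site d) (Λ : Finset (Site d))
    (e' : {x : Site d // x ∉ Λ} ≃ {x : Site d // x ∉ Λ.map e.toEmbedding})
    (he' : ∀ x, (e' x).1 = e x.1) (ζ : Λ.map e.toEmbedding → Circle)
    (ω : {x : Site d // x ∉ Λ.map e.toEmbedding} → Circle) :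
    (fun x => join (Λ.map e.toEmbedding) ζ ω (e x)) =
      join Λ (fun x => ζ (mapEquiv e Λ x)) fun x => ω (e' x) := by
  ext1 x
  by_cases hx : x ∈ Λ
  · rw [join, join, dif_pos hx]
    exact dif_pos (Finset.mem_map_of_mem e.toEmbedding hx)
  · have hx' : e x ∉ Λ.map e.toEmbedding := by simpa using hx
    rw [join, join, dif_neg hx, dif_neg hx']
    congr 1
    exact Subtype.ext (he' ⟨x, hx⟩).symm

theorem isTranslationInvariant_discreteSpec
    (hsum : Summable fun x : Site d => siteNorm x ^ (-α))
    (hex : ∀ (Λ : Finset (Site d)) (ω' : {x : Site d // x ∉ Λ} → Fin q),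
      ∃! μ, IsGibbs (restrictedSpec α β q Λ ω') μ) :
    IsTranslationInvariant (discreteSpec (d := d) α β q) := by
  intro Λ i η
  set e : Site d ≃ Site d := Equiv.addRight i with he
  have hmem : ∀ x : Site d, x ∉ Λ ↔ e x ∉ Λ.map e.toEmbedding := fun x => by simp
  let e' : {x : Site d // x ∉ Λ} ≃ {x : Site d // x ∉ Λ.map e.toEmbedding} :=
    e.subtypeEquiv hmem
  have he' : ∀ x, (e' x).1 = e x.1 := fun x => rfl
  have hsub : ∀ x y, (e' x).1 - (e' y).1 = x.1 - y.1 := fun x y => by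
    simp [he', he]
  have hη : (fun x : Site d => η (x - i)) = fun x => η (e.symm x) := by
    ext1 x; simp [he, sub_eq_add_neg]
  set η' : Site d → Fin q := fun x => η (e.symm x) with hη'
  have hsI : SummableCoupling (Subtype.val : {x : Site d // x ∉ Λ} → Site d) α :=
    summableCoupling_of_injective hsum Subtype.val_injective
  have hsJ : SummableCoupling (Subtype.val : {x : Site d // x ∉ Λ.map e.toEmbedding} → Site d) α :=
    summableCoupling_of_injective hsum Subtype.val_injective
  have hμ : (constrainedGibbs α β q (Λ.map e.toEmbedding) fun x => η' x) =
      (constrainedGibbs α β q Λ fun x => η x).map fun ω y => ω (e'.symm y) := by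
    have h1 := IsGibbs.map e' hsI hsJ hsub
      (isGibbs_constrainedGibbs (hex Λ fun x => η x))
    refine (hex (Λ.map e.toEmbedding) fun x => η' x).unique
      (isGibbs_constrainedGibbs (hex _ _)) ?_
    exact h1
  have hm : Measurable fun (ω : {x : Site d // x ∉ Λ} → Circle)
    (y : {x : Site d // x ∉ Λ.map e.toEmbedding}) => ω (e'.symm y) := by fun_prop
  have hb : ∀ ζ ω, boltzmannFactor id α β (Λ.map e.toEmbedding)
      (join (Λ.map e.toEmbedding) ζ fun y => ω (e'.symm y)) =
      boltzmannFactor id α β Λ (join Λ (fun x => ζ (mapEquiv e Λ x)) ω) := fun ζ ω => by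
    rw [boltzmannFactor, hamiltonian_map (posI := id) e α (fun x y => by simp [he]),
      join_map e Λ e' he']
    simp [boltzmannFactor]
  have hs : SummableCoupling (id : Site d → Site d) α :=
    summableCoupling_of_injective hsum Function.injective_id
  have hc : ∀ m, IsFiniteMeasure m → AEStronglyMeasurable (joinAverage α β (Λ.map e.toEmbedding) m)
      ((constrainedGibbs α β q Λ fun x => η x).map fun ω y => ω (e'.symm y)) := fun m _ =>
      (continuous_joinAverage hs _ m).aestronglyMeasurable
  rw [hη, discreteSpec_eq, discreteSpec_eq, hμ, integral_map hm.aemeasurable (hc _ inferInstance),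
    integral_map hm.aemeasurable (hc _ inferInstance)]
  simp only [joinAverage, hb]
  congr 1
  · refine integral_congr_ae (Eventually.of_forall fun ω => ?_)
    exact integral_boxMeasure_map e Λ η fun ζ => boltzmannFactor id α β Λ (join Λ ζ ω)
  · refine integral_congr_ae (Eventually.of_forall fun ω => ?_)
    exact integral_pi_map e Λ (fun _ => circleMeasure)
      fun ζ => boltzmannFactor id α β Λ (join Λ ζ ω)

/-! #### Nonnullness -/

theorem isNonnull_discreteSpec (hs : SummableCoupling (id : Site d → Site d) α)
    (hex : ∀ (Λ : Finset (Site d)) (ω' : {x : Site d // x ∉ Λ} → Fin q),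
      ∃! μ, IsGibbs (restrictedSpec α β q Λ ω') μ) :
    IsNonnull (discreteSpec (d := d) α β q) := by
  set L := |β| * hamiltonianBound (id : Site d → Site d) α {0} with hL
  set m₀ := (Measure.pi fun _ : ({0} : Finset (Site d)) => circleMeasure) with hm₀
  obtain ⟨k₀, hk₀⟩ := Finite.exists_min fun k : Fin q =>
    (boxMeasure (fun _ : Site d => k) {0}).real univ
  have hk₀pos := boxMeasure_real_univ_pos (fun _ : Site d => k₀) {0}
  have hm₀pos : 0 < m₀.real univ := hk₀pos.trans_le (boxMeasure_real_univ_le _ _)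
  refine ⟨(boxMeasure (fun _ : Site d => k₀) {0}).real univ * Real.exp (-L) /
    (m₀.real univ * Real.exp L), by positivity, fun η => ?_⟩
  have hμ := (isGibbs_constrainedGibbs (hex {0} fun x => η x)).1
  rw [discreteSpec_eq]
  have hN := integral_mono (μ := constrainedGibbs α β q {0} fun x => η x) (integrable_const _)
    (integrable_of_continuous (continuous_joinAverage hs {0} (boxMeasure η {0})))
    fun ω => le_joinAverage (β := β) hs {0} (boxMeasure η {0}) ω
  have hD := integral_mono (μ := constrainedGibbs α β q {0} fun x => η x)
    (integrable_of_continuous (continuous_joinAverage hs {0} m₀)) (integrable_const _)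
    fun ω => joinAverage_le (β := β) hs {0} m₀ ω
  have hD' := integral_mono (μ := constrainedGibbs α β q {0} fun x => η x) (integrable_const _)
    (integrable_of_continuous (continuous_joinAverage hs {0} m₀))
    fun ω => le_joinAverage (β := β) hs {0} m₀ ω
  simp only [integral_const, probReal_univ, one_smul] at hN hD hD'
  have hle : (boxMeasure (fun _ : Site d => k₀) {0}).real univ ≤ (boxMeasure η {0}).real univ := by
    rw [boxMeasure_singleton_congr (ω₁ := η) (ω₂ := fun _ => η 0) rfl]
    exact hk₀ (η 0)
  have hDpos := (mul_pos hm₀pos (Real.exp_pos (-L))).trans_le hD'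
  refine div_le_div₀ ?_ ?_ hDpos hD
  · exact le_trans (by positivity) hN
  · exact le_trans (mul_le_mul_of_nonneg_right hle (Real.exp_pos _).le) hN

/-! #### Summable oscillations -/

theorem abs_div_sub_div_le {N N' D D' δ : ℝ} (hδ : 0 < δ) (hD : δ ≤ D) (hD' : δ ≤ D')
    (hN' : 0 ≤ N') (hND' : N' ≤ D') :
    |N / D - N' / D'| ≤ δ⁻¹ * (|N - N'| + |D - D'|) := by
  have hDp : 0 < D := hδ.trans_le hD
  have hDp' : 0 < D' := hδ.trans_le hD'
  have h1 : N / D - N' / D' = D⁻¹ * ((N - N') + N' / D' * (D' - D)) := by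
    field_simp
    ring
  have h2 : |N' / D'| ≤ 1 := by
    rw [abs_of_nonneg (by positivity)]
    exact (div_le_one hDp').2 hND'
  rw [h1, abs_mul, abs_of_pos (inv_pos.2 hDp)]
  have h3 : |(N - N') + N' / D' * (D' - D)| ≤ |N - N'| + |D - D'| := by
    refine (abs_add_le _ _).trans (add_le_add le_rfl ?_)
    rw [abs_mul, abs_sub_comm D']
    exact mul_le_of_le_one_left (abs_nonneg _) h2
  have h4 : D⁻¹ ≤ δ⁻¹ := inv_anti₀ hδ hD
  exact mul_le_mul h4 h3 (abs_nonneg _) (by positivity)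

theorem tsum_oscillation_discreteSpec_lt_top {c : ℝ≥0∞}
    (hsum : Summable fun x : Site d => siteNorm x ^ (-α))
    (hC : ∀ x, ∑' y, interdependence
      (Subtype.val : {x : Site d // x ∉ ({0} : Finset (Site d))} → Site d) α β q x y ≤ c)
    (hc : c < 1)
    (hex : ∀ (Λ : Finset (Site d)) (ω' : {x : Site d // x ∉ Λ} → Fin q),
      ∃! μ, IsGibbs (restrictedSpec α β q Λ ω') μ) :
    ∑' x : {x : Site d // x ≠ 0}, oscillation x.1 (discreteSpec (d := d) α β q {0}) < ⊤ := by
  have hs : SummableCoupling (id : Site d → Site d) α :=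
    summableCoupling_of_injective hsum Function.injective_id
  have hs0 : SummableCoupling
      (Subtype.val : {x : Site d // x ∉ ({0} : Finset (Site d))} → Site d) α :=
    summableCoupling_of_injective hsum Subtype.val_injective
  set C := interdependence
    (Subtype.val : {x : Site d // x ∉ ({0} : Finset (Site d))} → Site d) α β q with hCdef
  set L := |β| * hamiltonianBound (id : Site d → Site d) α {0} with hL
  set m₀ := (Measure.pi fun _ : ({0} : Finset (Site d)) => circleMeasure) with hm₀
  set κ := m₀.real univ * (Real.exp L * (|β| * 2)) with hκ
  set δ := m₀.real univ * Real.exp (-L) with hδdef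
  set w : {x : Site d // x ∉ ({0} : Finset (Site d))} → ℝ≥0∞ := fun y =>
    ENNReal.ofReal (κ * coupling id α 0 y.1) with hw
  have hboxle : ∀ η : Site d → Fin q, (boxMeasure η {0}).real univ ≤ m₀.real univ := fun η =>
    boxMeasure_real_univ_le η {0}
  have hwfin : ∑' y, w y ≠ ⊤ :=
    Summable.tsum_ofReal_ne_top (((hs 0).mul_left κ).comp_injective Subtype.val_injective)
  have hosc : ∀ (m : Measure (({0} : Finset (Site d)) → Circle)) [IsFiniteMeasure m],
      m.real univ ≤ m₀.real univ → ∀ y, siteOsc y (joinAverage α β {0} m) ≤ w y := by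
    intro m _ hm y
    refine (siteOsc_joinAverage_le hs m y).trans (ENNReal.ofReal_le_ofReal ?_)
    have := coupling_nonneg (id : Site d → Site d) α 0 y.1
    exact mul_le_mul_of_nonneg_right (mul_le_mul_of_nonneg_right hm (by positivity)) this
  have key : ∀ x : {x : Site d // x ∉ ({0} : Finset (Site d))},
      oscillation x.1 (discreteSpec (d := d) α β q {0}) ≤
        ENNReal.ofReal δ⁻¹ * (2 * ∑' y, 2 * matGreen C y x * w y) := by
    intro x
    refine iSup_le fun η => iSup_le fun ξ => iSup_le fun h => ?_
    have hη := isGibbs_constrainedGibbs (hex {0} fun x => η x.1)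
    have hξ := isGibbs_constrainedGibbs (hex {0} fun x => ξ x.1)
    set μ := constrainedGibbs α β q {0} fun x => η x.1
    set ν := constrainedGibbs α β q {0} fun x => ξ x.1
    have hμ := hη.1
    have hν := hξ.1
    have hx0 : (0 : Site d) ≠ x.1 := fun h0 => x.2 (by simp [← h0])
    have hbeq : boxMeasure η {0} = boxMeasure ξ {0} := boxMeasure_singleton_congr (h 0 hx0)
    have hcomp : ∀ (m : Measure (({0} : Finset (Site d)) → Circle)) [IsFiniteMeasure m],
        m.real univ ≤ m₀.real univ →
        ENNReal.ofReal |∫ ω, joinAverage α β {0} m ω ∂μ - ∫ ω, joinAverage α β {0} m ω ∂ν| ≤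
          ∑' y, 2 * matGreen C y x * w y := by
      intro m _ hm
      have hfin : ∑' y, siteOsc y (joinAverage α β {0} m) ≠ ⊤ :=
        ne_top_of_le_ne_top hwfin (ENNReal.tsum_le_tsum (hosc m hm))
      refine (ofReal_abs_integral_sub_le_of_isGibbs hs0 hC hc hη hξ
        (a := fun y => 2 * matGreen C y x) (b := fun y => if y = x then 2 else 0)
        (fun y hy => ?_) (fun y => ?_) (continuous_joinAverage hs {0} m) hfin).trans ?_
      · rw [if_pos]
        by_contra hne
        exact hy (h y.1 fun e => hne (Subtype.ext e))
      · rw [matGreen_eq C y x, mul_add]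
        refine add_le_add (by split_ifs <;> simp) (le_of_eq ?_)
        rw [← ENNReal.tsum_mul_left]
        exact tsum_congr fun z => by ring
      · gcongr with y
        exact hosc m hm y
    have hint : ∀ (ρ : Measure ({x : Site d // x ∉ ({0} : Finset (Site d))} → Circle))
        [IsProbabilityMeasure ρ], δ ≤ ∫ ω, joinAverage α β {0} m₀ ω ∂ρ ∧
        0 ≤ ∫ ω, joinAverage α β {0} (boxMeasure ξ {0}) ω ∂ρ ∧
        ∫ ω, joinAverage α β {0} (boxMeasure ξ {0}) ω ∂ρ ≤
          ∫ ω, joinAverage α β {0} m₀ ω ∂ρ := by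
      intro ρ _
      have h1 := integral_mono (μ := ρ) (integrable_const _)
        (integrable_of_continuous (continuous_joinAverage hs {0} m₀))
        fun ω => le_joinAverage (β := β) hs {0} m₀ ω
      simp only [integral_const, probReal_univ, one_smul] at h1
      refine ⟨h1, integral_nonneg fun ω => integral_nonneg fun ζ =>
        (boltzmannFactor_pos id α β _ _).le, ?_⟩
      exact integral_mono
        (integrable_of_continuous (continuous_joinAverage hs {0} (boxMeasure ξ {0})))
        (integrable_of_continuous (continuous_joinAverage hs {0} m₀))
        fun ω => joinAverage_boxMeasure_le hs {0} ξ ω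
    have hδ : 0 < δ := mul_pos ((boxMeasure_real_univ_pos η {0}).trans_le (hboxle η))
      (Real.exp_pos _)
    rw [discreteSpec_eq, discreteSpec_eq, hbeq]
    refine (ENNReal.ofReal_le_ofReal (abs_div_sub_div_le hδ (hint μ).1 (hint ν).1 (hint ν).2.1
      (hint ν).2.2)).trans ?_
    rw [ENNReal.ofReal_mul (inv_pos.2 hδ).le, ENNReal.ofReal_add (abs_nonneg _) (abs_nonneg _),
      two_mul]
    gcongr
    · exact hcomp _ (hboxle ξ)
    · exact hcomp _ le_rfl
  calc ∑' x : {x : Site d // x ≠ 0}, oscillation x.1 (discreteSpec (d := d) α β q {0})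
      ≤ ∑' x : {x : Site d // x ∉ ({0} : Finset (Site d))},
          oscillation x.1 (discreteSpec (d := d) α β q {0}) :=
        ENNReal.tsum_comp_le_tsum_of_injective
          (f := fun x : {x : Site d // x ≠ 0} =>
            (⟨x.1, by simpa using x.2⟩ : {x : Site d // x ∉ ({0} : Finset (Site d))}))
          (fun x y hxy => Subtype.ext (Subtype.mk.inj hxy))
          fun x => oscillation x.1 (discreteSpec (d := d) α β q {0})
    _ ≤ ∑' x, ENNReal.ofReal δ⁻¹ * (2 * ∑' y, 2 * matGreen C y x * w y) :=
        ENNReal.tsum_le_tsum key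
    _ = ENNReal.ofReal δ⁻¹ * (2 * ∑' y, 2 * (∑' x, matGreen C y x) * w y) := by
        rw [ENNReal.tsum_mul_left, ENNReal.tsum_mul_left, ENNReal.tsum_comm]
        simp only [ENNReal.tsum_mul_left, ENNReal.tsum_mul_right]
    _ ≤ ENNReal.ofReal δ⁻¹ * (2 * ∑' y, 2 * (1 - c)⁻¹ * w y) := by
        gcongr with y
        exact tsum_matGreen_le C hC y
    _ < ⊤ := by
        rw [ENNReal.tsum_mul_left]
        have h1 : (1 - c)⁻¹ ≠ ⊤ := ENNReal.inv_ne_top.2 (tsub_pos_of_lt hc).ne'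
        exact ENNReal.mul_lt_top ENNReal.ofReal_lt_top (ENNReal.mul_lt_top (by simp)
          (ENNReal.mul_lt_top (ENNReal.mul_lt_top (by simp) h1.lt_top) hwfin.lt_top))

end DiscreteSpec

end LongRangeXY

theorem mainTheorem8 (d : ℕ) (hd : d = 1 ∨ d = 2) (α β : ℝ) (hα : (d : ℝ) < α)
    (hα' : α < 2 * d) (q : ℕ) [NeZero q]
    (hq : |β| * Real.pi * ∑' x : {x : LongRangeXY.Site d // x ≠ 0},
      LongRangeXY.siteNorm x.1 ^ (-α) < q) :
    (∀ (Λ : Finset (LongRangeXY.Site d))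
        (ω' : {x : LongRangeXY.Site d // x ∉ Λ} → Fin q),
      ∃! μ, LongRangeXY.IsGibbs (LongRangeXY.restrictedSpec α β q Λ ω') μ) ∧
    LongRangeXY.IsTranslationInvariant (LongRangeXY.discreteSpec (d := d) α β q) ∧
    LongRangeXY.IsNonnull (LongRangeXY.discreteSpec (d := d) α β q) ∧
    ∑' x : {x : LongRangeXY.Site d // x ≠ 0},
      LongRangeXY.oscillation x.1 (LongRangeXY.discreteSpec (d := d) α β q {0}) < ⊤ := by
  have hα0 : 0 < α := lt_of_le_of_lt (Nat.cast_nonneg d) hα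
  have hsum := LongRangeXY.summable_siteNorm_rpow hd hα
  have hq0 : (0 : ℝ) < q := Nat.cast_pos.mpr (NeZero.pos q)
  have hc : ENNReal.ofReal (|β| * Real.pi / q * ∑' x : {x : LongRangeXY.Site d // x ≠ 0},
      LongRangeXY.siteNorm x.1 ^ (-α)) < 1 := by
    rw [ENNReal.ofReal_lt_one, div_mul_eq_mul_div, div_lt_one hq0]
    exact hq
  have hC := fun Λ : Finset (LongRangeXY.Site d) =>
    LongRangeXY.tsum_interdependence_le (I := {x : LongRangeXY.Site d // x ∉ Λ}) hα0 β q hsum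
      Subtype.val_injective
  have hex : ∀ (Λ : Finset (LongRangeXY.Site d))
      (ω' : {x : LongRangeXY.Site d // x ∉ Λ} → Fin q),
      ∃! μ, LongRangeXY.IsGibbs (LongRangeXY.restrictedSpec α β q Λ ω') μ := fun Λ ω' =>
    LongRangeXY.existsUnique_isGibbs
      (LongRangeXY.summableCoupling_of_injective hsum Subtype.val_injective) (hC Λ) hc ω'
  exact ⟨hex, LongRangeXY.isTranslationInvariant_discreteSpec hsum hex,
    LongRangeXY.isNonnull_discreteSpec
      (LongRangeXY.summableCoupling_of_injective hsum Function.injective_id) hex,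
    LongRangeXY.tsum_oscillation_discreteSpec_lt_top hsum (hC {0}) hc hex⟩
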